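/- All digraphs are finite, loopless and have at least one vertex, and both arcs $(u,v),(v,u)$ may be present; write $u\to v$ if only $(u,v)$ is an arc and $u\leftrightarrow v$ if both are, pairs not mentioned being non-adjacent. $[k]=\{1,\dots,k\}$. For vertex-disjoint digraphs, $G\oplus H$ is the disjoint union; $G\oslash H$ is obtained from it by adding all arcs from $G$ to $H$; $G\otimes H$ is obtained from it by adding all arcs between $G$ and $H$ in both directions. $\bullet$ is a single vertex. $\mathrm{un}(G)$ is the underlying undirected graph. $\mathrm{Free}(F)$ is the class of (di)graphs with no induced sub(di)graph isomorphic to a member of $F$. **Widths.** The *directed linear NLC-width* $\mathrm{d\text{-}lnlcw}(G)$ is the least $k$ such that $G$ is, after forgetting labels and up to isomorphism, defined by an expression built from the following operations on digraphs with vertex labels in $[k]$: creating a single vertex with label $a$; adding to a labeled digraph a new vertex $v$ with label $a$ together with, for chosen relations $S,T\subseteq[k]^2$, all arcs $(u,v)$ with $u$ old and $(\mathrm{lab}(u),\mathrm{lab}(v))\in S$ and all arcs $(v,u)$ with $u$ old and $(\mathrm{lab}(u),\mathrm{lab}(v))\in T$; relabeling all vertices by a map $R:[k]\to[k]$. The *directed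 linear clique-width* $\mathrm{d\text{-}lcw}(G)$ is defined in the same way with the operations: creating a single vertex with label $a$; adding an isolated new vertex with label $a$; for labels $a\ne b$ inserting all arcs from vertices labeled $a$ to vertices labeled $b$; changing label $a$ into label $b$. The *directed neighbourhood-width* is $$\mathrm{d\text{-}nw}(G)=\min_{\varphi}\max_{1\le i\le |V|}\bigl|\{(N^+(u)\cap R_i,\;N^-(u)\cap R_i): u\in L_i\}\bigr|,$$ where $\varphi$ ranges over the bijections $V\to\{1,\dots,|V|\}$, $L_i=\{u:\varphi(u)\le i\}$ and $R_i=\{u:\varphi(u)>i\}$. **Classes.** *Directed threshold graphs* are the digraphs obtained from $\bullet$ by repeatedly replacing $G$ by $G\oplus\bullet$, $G\oslash\bullet$, $\bullet\oslash G$ or $G\otimes\bullet$. (Undirected) *threshold graphs* are the graphs obtained from a single vertex by repeatedly adding an isolated vertex or a vertex adjacent to all others. **Forbidden digraphs.** On vertices $0,1,2$: $D_1:\ 0\to1\to2$; $D_2:\ 0\to1\leftrightarrow2$; $D_3:\ 0\leftarrow1\leftrightarrow2$; $D_4:\ 0\to1\to2,\ 0\leftrightarrow2$; $D_5$: the directed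 3-cycle. On vertices $0,1,2,3$: $D_6:\ 0\to1\leftarrow2\to3$ with $0\leftrightarrow2$, $0\leftrightarrow3$, $1\leftrightarrow3$; $D_7:\ 0\to1\leftarrow2\to3$; $D_8:\ 0\leftrightarrow1\leftrightarrow2\leftrightarrow3$. With $I$ (two non-adjacent vertices), $A$ (two vertices joined by one arc) and $B$ (two vertices joined by both arcs): $D_9=I\otimes I$, $D_{10}=I\otimes A$, $D_{11}=A\otimes A$, $D_{12}=I\oslash I$, $D_{13}=I\oslash B$, $D_{14}=B\oslash I$, $D_{15}=B\oslash B$, $2\overrightarrow{P_2}=A\oplus A$, $\overrightarrow{P_2}\cup\overleftrightarrow{P_2}=A\oplus B$, $2\overleftrightarrow{P_2}=B\oplus B$. **Theorem.** For every digraph $G$ the following statements are equivalent. 1. $\mathrm{d\text{-}lnlcw}(G)=1$. 2. $\mathrm{d\text{-}nw}(G)=1$. 3. $\mathrm{d\text{-}lcw}(G)\le2$ and $G\in\mathrm{Free}(\{D_2,D_3,D_9,D_{10},D_{12},D_{13},D_{14}\})$. 4. $G$ is a directed threshold graph. 5. $G\in\mathrm{Free}(\{D_1,\dots,D_{15},2\overrightarrow{P_2},\overrightarrow{P_2}\cup\overleftrightarrow{P_2},2\overleftrightarrow{P_2}\})$.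 6. $G\in\mathrm{Free}(\{D_1,D_2,D_3,D_4,D_5,D_6,D_{10},D_{11},D_{13},D_{14},D_{15}\})$ and $\mathrm{un}(G)\in\mathrm{Free}(\{P_4,2K_2,C_4\})$. 7. $G\in\mathrm{Free}(\{D_1,D_2,D_3,D_4,D_5,D_6,D_{10},D_{11},D_{13},D_{14},D_{15}\})$ and $\mathrm{un}(G)$ is a threshold graph. -/

import Mathlib

namespace DirectedWidth

universe u v

/-! ### Operations on digraphs -/

/-- The disjoint union `G ⊕ H`. -/
def disjUnion {V : Type u} {W : Type v} (G : Digraph V) (H : Digraph W) : Digraph (V ⊕ W) where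
  Adj
    | .inl x, .inl y => G.Adj x y
    | .inr x, .inr y => H.Adj x y
    | .inl _, .inr _ => False
    | .inr _, .inl _ => False

/-- The order composition `G ⊘ H`: all arcs from `G` to `H` are added. -/
def orderComp {V : Type u} {W : Type v} (G : Digraph V) (H : Digraph W) : Digraph (V ⊕ W) where
  Adj
    | .inl x, .inl y => G.Adj x y
    | .inr x, .inr y => H.Adj x y
    | .inl _, .inr _ => True
    | .inr _, .inl _ => False

/-- The series composition `G ⊗ H`: all arcs between `G` and `H`, in both directions, are added. -/
def seriesComp {V : Type u} {W : Type v} (G : Digraph V) (H : Digraph W) : Digraph (V ⊕ W) where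
  Adj
    | .inl x, .inl y => G.Adj x y
    | .inr x, .inr y => H.Adj x y
    | .inl _, .inr _ => True
    | .inr _, .inl _ => True

/-- The digraph `•` with a single vertex and no arc. -/
def point : Digraph Unit := ⊥

/-- Isomorphism of digraphs. -/
def Isomorphic {V : Type u} {W : Type v} (G : Digraph V) (H : Digraph W) : Prop :=
  Nonempty (G.Adj ≃r H.Adj)

/-- Directed threshold graphs. As the operations are applied to vertex-disjoint digraphs whose
vertices have arbitrary names, the class is closed under isomorphism. -/
inductive IsDirectedThreshold : {V : Type u} → Digraph V → Prop
  | single : IsDirectedThreshold (⊥ : Digraph PUnit.{u + 1})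
  | union {V : Type u} {G : Digraph V} :
      IsDirectedThreshold G → IsDirectedThreshold (disjUnion G point)
  | order_right {V : Type u} {G : Digraph V} :
      IsDirectedThreshold G → IsDirectedThreshold (orderComp G point)
  | order_left {V : Type u} {G : Digraph V} :
      IsDirectedThreshold G → IsDirectedThreshold (orderComp point G)
  | series {V : Type u} {G : Digraph V} :
      IsDirectedThreshold G → IsDirectedThreshold (seriesComp G point)
  | iso {V W : Type u} {G : Digraph V} {H : Digraph W} :
      Isomorphic G H → IsDirectedThreshold G → IsDirectedThreshold H

/-- Undirected threshold graphs: graphs obtained from a single vertex by repeatedly adding an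
isolated vertex or a dominating vertex. -/
inductive IsThreshold : {V : Type u} → SimpleGraph V → Prop
  | single : IsThreshold (⊥ : SimpleGraph PUnit.{u + 1})
  | isolated {V : Type u} {G : SimpleGraph V} :
      IsThreshold G → IsThreshold (G.sum (⊥ : SimpleGraph Unit))
  | dominating {V : Type u} {G : SimpleGraph V} :
      IsThreshold G →
        IsThreshold (G.sum (⊥ : SimpleGraph Unit) ⊔ completeBipartiteGraph V Unit)
  | iso {V W : Type u} {G : SimpleGraph V} {H : SimpleGraph W} :
      Nonempty (G ≃g H) → IsThreshold G → IsThreshold H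

/-! ### Labeled digraphs, linear NLC-width and linear clique-width -/

/-- Digraphs whose vertices carry labels from a set of `k` labels. -/
structure LabeledDigraph (k : ℕ) where
  Vert : Type
  graph : Digraph Vert
  lab : Vert → Fin k

namespace LabeledDigraph

variable {k : ℕ}

/-- `•_a` -/
def single (a : Fin k) : LabeledDigraph k where
  Vert := Unit
  graph := point
  lab _ := a

/-- `G ⊗_(S, T) •_a`: a new vertex `v` with label `a` is added, together with the arcs `(u, v)` for
all old `u` with `(lab u, lab v) ∈ S` and the arcs `(v, u)` for all old `u` with
`(lab u, lab v) ∈ T`. -/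
def insertVertex (G : LabeledDigraph k) (S T : Set (Fin k × Fin k)) (a : Fin k) :
    LabeledDigraph k where
  Vert := G.Vert ⊕ Unit
  graph :=
    { Adj := fun x y =>
        match x, y with
        | .inl x, .inl y => G.graph.Adj x y
        | .inl x, .inr _ => (G.lab x, a) ∈ S
        | .inr _, .inl y => (G.lab y, a) ∈ T
        | .inr _, .inr _ => False }
  lab := Sum.elim G.lab fun _ => a

/-- `∘_R` -/
def relabel (G : LabeledDigraph k) (R : Fin k → Fin k) : LabeledDigraph k where
  Vert := G.Vert
  graph := G.graph
  lab := R ∘ G.lab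

/-- `G ⊕ •_a` -/
def addVertex (G : LabeledDigraph k) (a : Fin k) : LabeledDigraph k where
  Vert := G.Vert ⊕ Unit
  graph := disjUnion G.graph point
  lab := Sum.elim G.lab fun _ => a

/-- `α_{a,b}`: an arc is inserted from every vertex with label `a` to every vertex with
label `b`. -/
def addArcs (G : LabeledDigraph k) (a b : Fin k) : LabeledDigraph k where
  Vert := G.Vert
  graph := { Adj := fun x y => G.graph.Adj x y ∨ (G.lab x = a ∧ G.lab y = b) }
  lab := G.lab

end LabeledDigraph

/-- Directed linear NLC-width `k`-expressions. -/
inductive LinNLCExpr (k : ℕ) : Type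
  | single (a : Fin k) : LinNLCExpr k
  | insertVertex (X : LinNLCExpr k) (S T : Set (Fin k × Fin k)) (a : Fin k) : LinNLCExpr k
  | relabel (X : LinNLCExpr k) (R : Fin k → Fin k) : LinNLCExpr k

/-- The labeled digraph defined by a directed linear NLC-width expression. -/
def LinNLCExpr.val {k : ℕ} : LinNLCExpr k → LabeledDigraph k
  | .single a => .single a
  | .insertVertex X S T a => X.val.insertVertex S T a
  | .relabel X R => X.val.relabel R

/-- Directed linear clique-width `k`-expressions. -/
inductive LinCWExpr (k : ℕ) : Type
  | single (a : Fin k) : LinCWExpr k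
  | addVertex (X : LinCWExpr k) (a : Fin k) : LinCWExpr k
  | addArcs (X : LinCWExpr k) (a b : Fin k) (hab : a ≠ b) : LinCWExpr k
  | relabel (X : LinCWExpr k) (a b : Fin k) : LinCWExpr k

/-- The labeled digraph defined by a directed linear clique-width expression; `relabel X a b`
changes label `a` into label `b`. -/
def LinCWExpr.val {k : ℕ} : LinCWExpr k → LabeledDigraph k
  | .single a => .single a
  | .addVertex X a => X.val.addVertex a
  | .addArcs X a b _ => X.val.addArcs a b
  | .relabel X a b => X.val.relabel fun c => if c = a then b else c

/-- The directed linear NLC-width: the least `k` such that some `k`-expression defines `G` (up to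
the names of the vertices); it is `⊤` if there is no such `k`. -/
noncomputable def dlnlcw {V : Type u} (G : Digraph V) : ℕ∞ :=
  ⨅ k ∈ {k : ℕ | ∃ X : LinNLCExpr k, Isomorphic X.val.graph G}, (k : ℕ∞)

/-- The directed linear clique-width: the least `k` such that some `k`-expression defines `G` (up to
the names of the vertices); it is `⊤` if there is no such `k`. -/
noncomputable def dlcw {V : Type u} (G : Digraph V) : ℕ∞ :=
  ⨅ k ∈ {k : ℕ | ∃ X : LinCWExpr k, Isomorphic X.val.graph G}, (k : ℕ∞)

/-! ### Directed neighbourhood-width -/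

/-- The directed neighbourhood `N_W(x) = (N⁺_W(x), N⁻_W(x))` of a vertex into a vertex set. -/
def dirNbhd {V : Type u} (G : Digraph V) (W : Set V) (x : V) : Set V × Set V :=
  ({y ∈ W | G.Adj x y}, {y ∈ W | G.Adj y x})

/-- The directed neighbourhood-width: minimum over all layouts, maximum over all positions `i`, of
the number of directed neighbourhoods of vertices up to position `i` into the set of the later
vertices. -/
noncomputable def dnw {V : Type u} [Fintype V] (G : Digraph V) : ℕ∞ :=
  ⨅ φ : V ≃ Fin (Fintype.card V), ⨆ i : Fin (Fintype.card V),
    (dirNbhd G {x | i < φ x} '' {x | φ x ≤ i}).encard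

/-! ### Forbidden induced subdigraphs -/

/-- Digraphs with vertex set `{0, …, n - 1}`. -/
abbrev FinDigraph : Type := Σ n : ℕ, Digraph (Fin n)

/-- The digraph on `{0, …, n - 1}` with a given list of arcs. -/
def ofArcs (n : ℕ) (A : List (Fin n × Fin n)) : FinDigraph :=
  ⟨n, { Adj := fun x y => (x, y) ∈ A }⟩

/-- The subdigraph of `G` induced by a vertex set. -/
def induced {V : Type u} (G : Digraph V) (s : Set V) : Digraph s where
  Adj x y := G.Adj x y

/-- `G ∈ Free(F)`: no induced subdigraph of `G` is isomorphic to a member of `F`. -/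
def Free {V : Type u} (F : Set FinDigraph) (G : Digraph V) : Prop :=
  ∀ H ∈ F, ∀ s : Set V, ¬ Isomorphic (induced G s) H.2

/-- `0 → 1 → 2` -/
def D1 : FinDigraph := ofArcs 3 [(0, 1), (1, 2)]
/-- `0 → 1 ↔ 2` -/
def D2 : FinDigraph := ofArcs 3 [(0, 1), (1, 2), (2, 1)]
/-- `0 ← 1 ↔ 2` -/
def D3 : FinDigraph := ofArcs 3 [(1, 0), (1, 2), (2, 1)]
/-- `0 → 1 → 2` and `0 ↔ 2` -/
def D4 : FinDigraph := ofArcs 3 [(0, 1), (1, 2), (0, 2), (2, 0)]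
/-- The directed cycle on three vertices. -/
def D5 : FinDigraph := ofArcs 3 [(0, 1), (1, 2), (2, 0)]
/-- `0 → 1 ← 2 → 3`, the three other pairs being joined in both directions. -/
def D6 : FinDigraph :=
  ofArcs 4 [(0, 1), (2, 1), (2, 3), (0, 2), (2, 0), (0, 3), (3, 0), (1, 3), (3, 1)]
/-- `0 → 1 ← 2 → 3` -/
def D7 : FinDigraph := ofArcs 4 [(0, 1), (2, 1), (2, 3)]
/-- The complete biorientation of the path on four vertices. -/
def D8 : FinDigraph := ofArcs 4 [(0, 1), (1, 0), (1, 2), (2, 1), (2, 3), (3, 2)]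
/-- Series composition of two non-adjacent vertices and two non-adjacent vertices. -/
def D9 : FinDigraph :=
  ofArcs 4 [(0, 2), (2, 0), (0, 3), (3, 0), (1, 2), (2, 1), (1, 3), (3, 1)]
/-- Series composition of two non-adjacent vertices and an arc. -/
def D10 : FinDigraph :=
  ofArcs 4 [(0, 2), (2, 0), (0, 3), (3, 0), (1, 2), (2, 1), (1, 3), (3, 1), (2, 3)]
/-- Series composition of an arc and an arc. -/
def D11 : FinDigraph :=
  ofArcs 4 [(0, 2), (2, 0), (0, 3), (3, 0), (1, 2), (2, 1), (1, 3), (3, 1), (0, 1), (2, 3)]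
/-- Order composition of two non-adjacent vertices and two non-adjacent vertices. -/
def D12 : FinDigraph := ofArcs 4 [(0, 2), (0, 3), (1, 2), (1, 3)]
/-- Order composition of two non-adjacent vertices and `2 ↔ 3`. -/
def D13 : FinDigraph := ofArcs 4 [(0, 2), (0, 3), (1, 2), (1, 3), (2, 3), (3, 2)]
/-- Order composition of `0 ↔ 1` and two non-adjacent vertices. -/
def D14 : FinDigraph := ofArcs 4 [(0, 2), (0, 3), (1, 2), (1, 3), (0, 1), (1, 0)]
/-- Order composition of `0 ↔ 1` and `2 ↔ 3`. -/
def D15 : FinDigraph :=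
  ofArcs 4 [(0, 2), (0, 3), (1, 2), (1, 3), (0, 1), (1, 0), (2, 3), (3, 2)]
/-- `0 → 1` and `2 → 3` -/
def twoDirP2 : FinDigraph := ofArcs 4 [(0, 1), (2, 3)]
/-- `0 → 1` and `2 ↔ 3` -/
def dirP2BiP2 : FinDigraph := ofArcs 4 [(0, 1), (2, 3), (3, 2)]
/-- `0 ↔ 1` and `2 ↔ 3` -/
def twoBiP2 : FinDigraph := ofArcs 4 [(0, 1), (1, 0), (2, 3), (3, 2)]

/-- The underlying undirected graph. -/
abbrev un {V : Type u} (G : Digraph V) : SimpleGraph V := G.toSimpleGraphInclusive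

/-- `{P₄, 2K₂, C₄}`-free undirected graphs. -/
def FreeP4TwoK2C4 {V : Type u} (G : SimpleGraph V) : Prop :=
  ¬ (SimpleGraph.pathGraph 4).IsIndContained G ∧
  ¬ ((⊤ : SimpleGraph (Fin 2)).sum (⊤ : SimpleGraph (Fin 2))).IsIndContained G ∧
  ¬ (SimpleGraph.cycleGraph 4).IsIndContained G

end DirectedWidth

open DirectedWidth

namespace DirectedWidth

universe u v

/-! All conditions are compared with one property, `Dismantlable`: every nonempty vertex set `S`
contains a vertex related in the same way to all other vertices of `S`. Removing such vertices one
by one and reversing the order is a directed threshold construction. With a single label a new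
vertex cannot distinguish the old ones, and neighbourhood-width 1 says that no later vertex
distinguishes two earlier ones, so both widths express the same property. Two labels only give
`WeaklyDismantlable`, which excludes eleven of the eighteen forbidden digraphs; statement 3 excludes
the other seven explicitly.

The hard part is that excluding all eighteen suffices (`ThresholdFree.dismantlable`). Consider the
undirected graph of pairs joined by exactly one arc (`SingleArc`). An alternating 4-cycle in it
would produce a forbidden digraph (`ThresholdFree.singleArc_alt`), so on every `S` it has an
isolated or a dominating vertex (`exists_isolated_or_dominating`). In the dominating case, the
dominating vertices with one representative of the rest form a transitive tournament, whose source
or sink is homogeneous in `S`. In the isolated case, the isolated vertices with one representative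
of the rest carry a symmetric relation, again without alternating 4-cycles.

For statements 6 and 7, the forbidden digraphs missing from the list are exactly those whose
underlying graph is P₄, C₄ or 2K₂. -/

/-! ### Dismantling by homogeneous vertices -/

/-- The element `v` is related in the same way to all other elements of `S`. -/
def HomogeneousIn {V : Type u} (r : V → V → Prop) (S : Set V) (v : V) : Prop :=
  ∀ x ∈ S, ∀ y ∈ S, x ≠ v → y ≠ v → (r v x → r v y) ∧ (r x v → r y v)

/-- Every nonempty set of vertices has a homogeneous element. -/
def Dismantlable {V : Type u} (r : V → V → Prop) : Prop :=
  ∀ S : Set V, S.Nonempty → ∃ v ∈ S, HomogeneousIn r S v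

theorem Dismantlable.comap {V : Type u} {W : Type v} {r : V → V → Prop} {s : W → W → Prop}
    (hr : Dismantlable r) (f : W → V) (hf : Function.Injective f)
    (h : ∀ x y, s x y ↔ r (f x) (f y)) : Dismantlable s := by
  rintro S hS
  obtain ⟨_, ⟨v, hv, rfl⟩, hom⟩ := hr (f '' S) (hS.image f)
  refine ⟨v, hv, fun x hx y hy hxv hyv => ?_⟩
  simpa only [h] using hom (f x) ⟨x, hx, rfl⟩ (f y) ⟨y, hy, rfl⟩ (hf.ne hxv) (hf.ne hyv)

theorem Dismantlable.of_iso {V : Type u} {W : Type v} {r : V → V → Prop} {s : W → W → Prop}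
    (hr : Dismantlable r) (e : Nonempty (r ≃r s)) : Dismantlable s := by
  obtain ⟨e⟩ := e
  exact hr.comap e.symm e.symm.injective fun x y => (e.symm.map_rel_iff).symm

/-- Adding a homogeneous vertex preserves dismantlability. -/
theorem Dismantlable.extend {V : Type u} {W : Type v} {r : V → V → Prop} {s : W → W → Prop}
    (hr : Dismantlable r) (f : V → W) (w : W) (hw : ∀ y, y = w ∨ ∃ x, f x = y)
    (h : ∀ x y, s (f x) (f y) ↔ r x y) (hom : HomogeneousIn s Set.univ w) :
    Dismantlable s := by
  rintro S hS
  by_cases hwS : w ∈ S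
  · exact ⟨w, hwS, fun x _ y _ => hom x trivial y trivial⟩
  have key : ∀ y ∈ S, ∃ x, f x = y := fun y hy =>
    (hw y).resolve_left (by rintro rfl; exact hwS hy)
  obtain ⟨y, hy⟩ := hS
  obtain ⟨x, rfl⟩ := key y hy
  obtain ⟨v, hv, hom'⟩ := hr (f ⁻¹' S) ⟨x, hy⟩
  refine ⟨f v, hv, fun a ha b hb hav hbv => ?_⟩
  obtain ⟨a, rfl⟩ := key a ha
  obtain ⟨b, rfl⟩ := key b hb
  simpa only [h] using hom' a ha b hb (by rintro rfl; exact hav rfl) (by rintro rfl; exact hbv rfl)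

theorem Dismantlable.of_subsingleton {V : Type u} [Subsingleton V] (r : V → V → Prop) :
    Dismantlable r := by
  rintro S ⟨v, hv⟩
  exact ⟨v, hv, fun x _ _ _ hx => (hx (Subsingleton.elim x v)).elim⟩

/-- Induction along a dismantling order. -/
theorem Dismantlable.finset_induction {V : Type u} [Finite V] [DecidableEq V]
    {r : V → V → Prop} (hr : Dismantlable r) {motive : Finset V → Prop}
    (single : ∀ v, motive {v})
    (step : ∀ (S : Finset V) (v : V), S.Nonempty → v ∉ S →
      (∀ x ∈ S, ∀ y ∈ S, (r v x ↔ r v y) ∧ (r x v ↔ r y v)) → motive S → motive (insert v S))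
    (S : Finset V) (hS : S.Nonempty) : motive S := by
  induction S using Finset.strongInduction with
  | H S ih =>
    obtain ⟨v, hv, hom⟩ := hr (S : Set V) hS
    have hv' : v ∈ S := hv
    rcases (S.erase v).eq_empty_or_nonempty with h | h
    · have : S = {v} := by rw [← Finset.insert_erase hv', h]; rfl
      exact this ▸ single v
    · rw [← Finset.insert_erase hv']
      refine step _ _ h (Finset.notMem_erase v S) (fun x hx y hy => ?_)
        (ih _ (Finset.erase_ssubset hv') h)
      rw [Finset.mem_erase] at hx hy
      have h1 := hom x hx.2 y hy.2 hx.1 hy.1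
      have h2 := hom y hy.2 x hx.2 hy.1 hx.1
      exact ⟨⟨h1.1, h2.1⟩, ⟨h1.2, h2.2⟩⟩

/-! ### Isomorphisms onto growing vertex sets -/

/-- Gluing a homogeneous vertex to an isomorphism onto an induced substructure. -/
theorem iso_insert {V : Type u} {W : Type v} [DecidableEq V] {r : V → V → Prop}
    {h : W → W → Prop} {k : W ⊕ Unit → W ⊕ Unit → Prop} {S : Finset V} {v : V} (hv : v ∉ S)
    (e : Nonempty (h ≃r fun x y : (S : Set V) => r x y))
    (hll : ∀ x y, k (.inl x) (.inl y) ↔ h x y)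
    (hlr : ∀ x, ∀ s ∈ S, k (.inl x) (.inr ()) ↔ r s v)
    (hrl : ∀ x, ∀ s ∈ S, k (.inr ()) (.inl x) ↔ r v s)
    (hrr : k (.inr ()) (.inr ()) ↔ r v v) :
    Nonempty (k ≃r fun x y : ((insert v S : Finset V) : Set V) => r x y) := by
  obtain ⟨e⟩ := e
  let f : W ⊕ Unit ≃ ((insert v S : Finset V) : Set V) :=
    ((Equiv.sumCongr e.toEquiv (Equiv.equivPUnit.{_, u + 1} Unit)).trans
      (Equiv.Set.insert (s := (S : Set V)) (a := v) (by simpa using hv)).symm).trans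
      (Equiv.setCongr (Finset.coe_insert v S).symm)
  have fl : ∀ x, (f (.inl x) : V) = e x := fun x => rfl
  have fr : (f (.inr ()) : V) = v := rfl
  refine ⟨⟨f, ?_⟩⟩
  rintro (x | x) (y | y)
  · rw [hll, fl, fl]; exact e.map_rel_iff
  · rw [hlr x (e x) (e x).2, fl, fr]
  · rw [hrl y (e y) (e y).2, fl, fr]
  · rw [hrr, fr]

theorem iso_singleton {V : Type u} {r : V → V → Prop} (hr : ∀ x, ¬ r x x) {W : Type v} [Unique W]
    {h : W → W → Prop} (hh : ∀ x, ¬ h x x) (v : V) :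
    Nonempty (h ≃r fun x y : (({v} : Finset V) : Set V) => r x y) := by
  have : Unique (({v} : Finset V) : Set V) := 
    ⟨⟨⟨v, by simp⟩⟩, fun x => Subtype.ext (by simpa using x.2)⟩
  refine ⟨⟨Equiv.ofUnique _ _, ?_⟩⟩
  intro x y
  rw [Subsingleton.elim x y]
  exact iff_of_false (hr _) (hh _)

theorem iso_univ {V : Type u} [Fintype V] (r : V → V → Prop) :
    Nonempty ((fun x y : ((Finset.univ : Finset V) : Set V) => r x y) ≃r r) :=
  ⟨⟨(Equiv.setCongr (by simp)).trans (Equiv.Set.univ V), Iff.rfl⟩⟩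

/-! ### Constructions yield dismantlability -/

theorem Dismantlable.of_isDirectedThreshold {V : Type u} {G : Digraph V}
    (h : IsDirectedThreshold G) : Dismantlable G.Adj := by
  induction h with
  | single => exact .of_subsingleton _
  | iso e _ ih => exact ih.of_iso e
  | union _ ih =>
    refine ih.extend Sum.inl (.inr ()) (by rintro (x | x) <;> simp) (fun _ _ => Iff.rfl) ?_
    rintro (x | x) _ (y | y) _ hx hy <;> simp_all [disjUnion]
  | order_right _ ih =>
    refine ih.extend Sum.inl (.inr ()) (by rintro (x | x) <;> simp) (fun _ _ => Iff.rfl) ?_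
    rintro (x | x) _ (y | y) _ hx hy <;> simp_all [orderComp]
  | order_left _ ih =>
    refine ih.extend Sum.inr (.inl ()) (by rintro (x | x) <;> simp) (fun _ _ => Iff.rfl) ?_
    rintro (x | x) _ (y | y) _ hx hy <;> simp_all [orderComp]
  | series _ ih =>
    refine ih.extend Sum.inl (.inr ()) (by rintro (x | x) <;> simp) (fun _ _ => Iff.rfl) ?_
    rintro (x | x) _ (y | y) _ hx hy <;> simp_all [seriesComp]

theorem Dismantlable.of_isThreshold {V : Type u} {G : SimpleGraph V}
    (h : IsThreshold G) : Dismantlable G.Adj := by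
  induction h with
  | single => exact .of_subsingleton _
  | iso e _ ih => exact ih.of_iso e
  | isolated _ ih =>
    refine ih.extend Sum.inl (.inr ()) (by rintro (x | x) <;> simp) (fun _ _ => by simp) ?_
    rintro (x | x) _ (y | y) _ hx hy <;> simp_all
  | dominating _ ih =>
    refine ih.extend Sum.inl (.inr ()) (by rintro (x | x) <;> simp) (fun _ _ => by simp) ?_
    rintro (x | x) _ (y | y) _ hx hy <;> simp_all

/-- All labels coincide, so `S` and `T` are each tested at a single pair and the inserted vertex is
homogeneous; relabelings change no arc. -/
theorem Dismantlable.of_linNLCExpr (X : LinNLCExpr 1) : Dismantlable X.val.graph.Adj := by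
  induction X with
  | single a => exact @Dismantlable.of_subsingleton Unit _ _
  | relabel X R ih => exact ih
  | insertVertex X S T a ih =>
    refine ih.extend Sum.inl (.inr ()) (by
      rintro (x | x)
      exacts [.inr ⟨x, rfl⟩, .inl rfl]) (fun _ _ => Iff.rfl) ?_
    rintro (x | x) _ (y | y) _ hx hy <;>
      simp_all [LinNLCExpr.val, LabeledDigraph.insertVertex, Subsingleton.elim (X.val.lab _) a]

/-! ### Dismantlability yields constructions -/

theorem exists_const_of_homogeneous {V : Type u} {r : V → V → Prop} {S : Finset V} {v : V}
    (hS : S.Nonempty) (hom : ∀ x ∈ S, ∀ y ∈ S, (r v x ↔ r v y) ∧ (r x v ↔ r y v)) :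
    ∃ p q : Prop, ∀ s ∈ S, (r v s ↔ p) ∧ (r s v ↔ q) := by
  obtain ⟨t, ht⟩ := hS
  exact ⟨r v t, r t v, fun s hs => hom s hs t ht⟩

theorem Dismantlable.isDirectedThreshold {V : Type u} [Fintype V] [Nonempty V] {G : Digraph V}
    (hG : Dismantlable G.Adj) (loopless : ∀ x, ¬ G.Adj x x) : IsDirectedThreshold G := by
  classical
  refine .iso (iso_univ G.Adj) (G := induced G _) (hG.finset_induction
    (motive := fun S => IsDirectedThreshold (induced G (S : Set V))) ?_ ?_ Finset.univ
    Finset.univ_nonempty)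
  · exact fun v => .iso (iso_singleton loopless (fun x h => h) v) .single
  · intro S v hS hv hom ih
    obtain ⟨p, q, hpq⟩ := exists_const_of_homogeneous hS hom
    have refl : Nonempty ((induced G (S : Set V)).Adj ≃r fun x y : (S : Set V) => G.Adj x y) :=
      ⟨RelIso.refl _⟩
    by_cases hp : p <;> by_cases hq : q
    · refine .iso (iso_insert hv refl ?_ ?_ ?_ ?_) ih.series <;>
        simp_all [seriesComp, point]
    -- Here the point is the left summand, whereas `iso_insert` expects the new vertex on the right,
    -- so the summands are swapped first.
    · have key : Nonempty ((orderComp point (induced G (S : Set V))).Adj ≃r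
          fun x y => (orderComp point (induced G (S : Set V))).Adj (Sum.swap x) (Sum.swap y)) :=
        ⟨⟨Equiv.sumComm _ _, by simp⟩⟩
      obtain ⟨e₁⟩ := key
      have key₂ := iso_insert (k := fun x y =>
        (orderComp point (induced G (S : Set V))).Adj (Sum.swap x) (Sum.swap y)) hv refl
        (by simp [orderComp]) (by simp_all [orderComp]) (by simp_all [orderComp])
        (by simp_all [orderComp, point])
      obtain ⟨e₂⟩ := key₂
      exact .iso ⟨e₁.trans e₂⟩ ih.order_left
    · refine .iso (iso_insert hv refl ?_ ?_ ?_ ?_) ih.order_right <;>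
        simp_all [orderComp, point]
    · refine .iso (iso_insert hv refl ?_ ?_ ?_ ?_) ih.union <;>
        simp_all [disjUnion, point]

theorem Dismantlable.isThreshold {V : Type u} [Fintype V] [Nonempty V] {G : SimpleGraph V}
    (hG : Dismantlable G.Adj) : IsThreshold G := by
  classical
  refine .iso (iso_univ G.Adj) (G := G.induce _) (hG.finset_induction
    (motive := fun S => IsThreshold (G.induce (S : Set V))) ?_ ?_ Finset.univ
    Finset.univ_nonempty)
  · exact fun v => .iso (iso_singleton (fun _ => G.irrefl) (fun x h => h) v) .single
  · intro S v hS hv hom ih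
    obtain ⟨p, q, hpq⟩ := exists_const_of_homogeneous hS hom
    have refl : Nonempty ((G.induce (S : Set V)).Adj ≃r fun x y : (S : Set V) => G.Adj x y) :=
      ⟨RelIso.refl _⟩
    have hq : ∀ s ∈ S, (G.Adj s v ↔ p) := fun s hs => by rw [G.adj_comm]; exact (hpq s hs).1
    by_cases hp : p
    · refine .iso (iso_insert hv refl ?_ ?_ ?_ ?_) ih.dominating <;> simp_all
    · refine .iso (iso_insert hv refl ?_ ?_ ?_ ?_) ih.isolated <;> simp_all

theorem Dismantlable.exists_linNLCExpr {V : Type u} [Fintype V] [Nonempty V] {G : Digraph V}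
    (hG : Dismantlable G.Adj) (loopless : ∀ x, ¬ G.Adj x x) :
    ∃ X : LinNLCExpr 1, Isomorphic X.val.graph G := by
  classical
  have key := hG.finset_induction
    (motive := fun S => ∃ X : LinNLCExpr 1, Isomorphic X.val.graph (induced G (S : Set V)))
    (fun v => ⟨.single 0, iso_singleton (W := Unit) loopless (fun x h => h) v⟩) ?_ Finset.univ
    Finset.univ_nonempty
  · obtain ⟨X, ⟨e⟩⟩ := key
    obtain ⟨e'⟩ := iso_univ G.Adj
    exact ⟨X, ⟨e.trans e'⟩⟩
  · rintro S v hS hv hom ⟨X, e⟩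
    obtain ⟨p, q, hpq⟩ := exists_const_of_homogeneous hS hom
    -- With one label the relations are either full or empty, as dictated by `q` (arcs towards `v`)
    -- and `p` (arcs from `v`).
    exact ⟨.insertVertex X {_x | q} {_x | p} 0, iso_insert hv e (fun _ _ => Iff.rfl)
      (fun _ s hs => (hpq s hs).2.symm) (fun _ s hs => (hpq s hs).1.symm)
      (iff_of_false id (loopless v))⟩

/-- Label 0 is kept on all vertices between rounds. A vertex to be joined enters with label 1, which
separates it from the old vertices while arcs are inserted, and is then relabeled to 0. -/
theorem Dismantlable.exists_linCWExpr {V : Type u} [Fintype V] [Nonempty V] {G : Digraph V}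
    (hG : Dismantlable G.Adj) (loopless : ∀ x, ¬ G.Adj x x) :
    ∃ X : LinCWExpr 2, Isomorphic X.val.graph G := by
  classical
  have key := hG.finset_induction
    (motive := fun S => ∃ X : LinCWExpr 2, (∀ x, X.val.lab x = 0) ∧
      Isomorphic X.val.graph (induced G (S : Set V)))
    (fun v => ⟨.single 0, fun _ => rfl, iso_singleton (W := Unit) loopless (fun x h => h) v⟩) ?_
    Finset.univ Finset.univ_nonempty
  · obtain ⟨X, -, ⟨e⟩⟩ := key
    obtain ⟨e'⟩ := iso_univ G.Adj
    exact ⟨X, ⟨e.trans e'⟩⟩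
  · rintro S v hS hv hom ⟨X, hX, e⟩
    obtain ⟨p, q, hpq⟩ := exists_const_of_homogeneous hS hom
    by_cases hp : p <;> by_cases hq : q
    · refine ⟨.relabel (.addArcs (.addArcs (.addVertex X 1) 0 1 (by simp)) 1 0 (by simp)) 1 0,
        by rintro (x | x) <;> simp [LinCWExpr.val, LabeledDigraph.relabel, LabeledDigraph.addArcs,
          LabeledDigraph.addVertex, hX], iso_insert hv e ?_ ?_ ?_ ?_⟩ <;>
      simp_all [LinCWExpr.val, LabeledDigraph.relabel, LabeledDigraph.addArcs,
          LabeledDigraph.addVertex, disjUnion, point]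
    · refine ⟨.relabel (.addArcs (.addVertex X 1) 1 0 (by simp)) 1 0,
        by rintro (x | x) <;> simp [LinCWExpr.val, LabeledDigraph.relabel, LabeledDigraph.addArcs,
          LabeledDigraph.addVertex, hX], iso_insert hv e ?_ ?_ ?_ ?_⟩ <;>
      simp_all [LinCWExpr.val, LabeledDigraph.relabel, LabeledDigraph.addArcs,
          LabeledDigraph.addVertex, disjUnion, point]
    · refine ⟨.relabel (.addArcs (.addVertex X 1) 0 1 (by simp)) 1 0,
        by rintro (x | x) <;> simp [LinCWExpr.val, LabeledDigraph.relabel, LabeledDigraph.addArcs,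
          LabeledDigraph.addVertex, hX], iso_insert hv e ?_ ?_ ?_ ?_⟩ <;>
      simp_all [LinCWExpr.val, LabeledDigraph.relabel, LabeledDigraph.addArcs,
          LabeledDigraph.addVertex, disjUnion, point]
    · refine ⟨.addVertex X 0,
        by rintro (x | x) <;> simp [LinCWExpr.val, LabeledDigraph.addVertex, hX],
        iso_insert hv e ?_ ?_ ?_ ?_⟩ <;>
      simp_all [LinCWExpr.val, LabeledDigraph.addVertex, disjUnion, point]

/-! ### Layouts and neighbourhood-width -/

theorem Dismantlable.exists_layout {V : Type u} [Fintype V] [Nonempty V] {r : V → V → Prop}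
    (hr : Dismantlable r) :
    ∃ φ : V ≃ Fin (Fintype.card V), ∀ x y v, φ x < φ v → φ y < φ v →
      (r v x ↔ r v y) ∧ (r x v ↔ r y v) := by
  classical
  have key := hr.finset_induction
    (motive := fun S => ∃ f : V → ℕ, Set.InjOn f S ∧ ∀ x ∈ S, ∀ y ∈ S, ∀ v ∈ S,
      f x < f v → f y < f v → (r v x ↔ r v y) ∧ (r x v ↔ r y v))
    (fun v => ⟨fun _ => 0, by simp, by simp⟩) ?_ Finset.univ Finset.univ_nonempty
  · obtain ⟨f, hf, H⟩ := key
    have hf' : Function.Injective f := by simpa [Set.injOn_univ] using hf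
    let _ : LinearOrder V := LinearOrder.lift' f hf'
    let φ := Fintype.orderIsoFinOfCardEq V rfl
    refine ⟨φ.symm.toEquiv, fun x y v hx hy => ?_⟩
    have hx' : x < v := φ.symm.lt_iff_lt.mp hx
    have hy' : y < v := φ.symm.lt_iff_lt.mp hy
    exact H x (by simp) y (by simp) v (by simp) hx' hy'
  · rintro S v hS hv hom ⟨f, hf, H⟩
    -- The added vertex gets the rank `S.sup f + 1`, larger than every rank used so far.
    have hlt : ∀ x ∈ S, f x < S.sup f + 1 := fun x hx =>
      Nat.lt_succ_of_le (Finset.le_sup (f := f) hx)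
    have hne : ∀ x ∈ S, x ≠ v := fun x hx h => hv (h ▸ hx)
    have hS' : ∀ x ∈ S, Function.update f v (S.sup f + 1) x = f x := fun x hx =>
      Function.update_of_ne (hne x hx) _ _
    have hv' : Function.update f v (S.sup f + 1) v = S.sup f + 1 := Function.update_self ..
    refine ⟨Function.update f v (S.sup f + 1), ?_, ?_⟩
    · intro x hx y hy hxy
      rw [Finset.mem_coe, Finset.mem_insert] at hx hy
      rcases hx with rfl | hx <;> rcases hy with rfl | hy
      · rfl
      · rw [hv', hS' y hy] at hxy; exact absurd hxy (hlt y hy).ne'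
      · rw [hv', hS' x hx] at hxy; exact absurd hxy (hlt x hx).ne
      · rw [hS' x hx, hS' y hy] at hxy; exact hf hx hy hxy
    · intro x hx y hy w hw hxw hyw
      rw [Finset.mem_insert] at hx hy hw
      rcases hw with rfl | hw
      · have hx : x ∈ S := hx.resolve_left (by rintro rfl; exact lt_irrefl _ hxw)
        have hy : y ∈ S := hy.resolve_left (by rintro rfl; exact lt_irrefl _ hyw)
        exact hom x hx y hy
      · have hx : x ∈ S := hx.resolve_left (by
          rintro rfl; rw [hv', hS' w hw] at hxw; exact lt_asymm hxw (hlt w hw))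
        have hy : y ∈ S := hy.resolve_left (by
          rintro rfl; rw [hv', hS' w hw] at hyw; exact lt_asymm hyw (hlt w hw))
        rw [hS' x hx, hS' w hw] at hxw
        rw [hS' y hy, hS' w hw] at hyw
        exact H x hx y hy w hw hxw hyw

theorem one_le_dnw {V : Type u} [Fintype V] [Nonempty V] (G : Digraph V) : 1 ≤ dnw G := by
  refine le_iInf fun φ => ?_
  obtain ⟨x⟩ := ‹Nonempty V›
  refine le_trans ?_ (le_iSup _ (φ x))
  rw [Set.one_le_encard_iff_nonempty]
  exact ⟨_, x, le_refl (φ x), rfl⟩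

/-- In an optimal layout the last vertex `v` of `S` is homogeneous: two other vertices of `S` both
lie before the cut at the later of them, and `v` lies beyond it. Conversely, a dismantling order
gives a layout with one neighbourhood at every cut. -/
theorem dnw_eq_one_iff {V : Type u} [Fintype V] [Nonempty V] (G : Digraph V) :
    dnw G = 1 ↔ Dismantlable G.Adj := by
  classical
  constructor
  · intro h
    have : Nonempty (V ≃ Fin (Fintype.card V)) := ⟨Fintype.equivFin V⟩
    -- The infimum over layouts is attained.
    obtain ⟨φ, hφ⟩ := ciInf_mem (fun φ : V ≃ Fin (Fintype.card V) =>
      ⨆ i : Fin (Fintype.card V), (dirNbhd G {x | i < φ x} '' {x | φ x ≤ i}).encard)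
    have key : ∀ i : Fin (Fintype.card V),
        (dirNbhd G {x | i < φ x} '' {x | φ x ≤ i}).encard ≤ 1 := fun i =>
      (le_iSup (fun i : Fin (Fintype.card V) =>
        (dirNbhd G {x | i < φ x} '' {x | φ x ≤ i}).encard) i).trans (hφ.trans h).le
    intro S hS
    obtain ⟨v, hv, hmax⟩ := Set.exists_max_image S φ S.toFinite hS
    refine ⟨v, hv, fun x hx y hy hxv hyv => ?_⟩
    have hx' : φ x < φ v := lt_of_le_of_ne (hmax x hx) (φ.injective.ne hxv)
    have hy' : φ y < φ v := lt_of_le_of_ne (hmax y hy) (φ.injective.ne hyv)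
    have main : dirNbhd G {z | max (φ x) (φ y) < φ z} x =
        dirNbhd G {z | max (φ x) (φ y) < φ z} y :=
      Set.encard_le_one_iff.mp (key (max (φ x) (φ y))) _ _
        ⟨x, le_max_left (φ x) (φ y), rfl⟩ ⟨y, le_max_right (φ x) (φ y), rfl⟩
    have hvm : max (φ x) (φ y) < φ v := max_lt hx' hy'
    rw [dirNbhd, dirNbhd, Prod.mk.injEq] at main
    constructor
    · intro hvx
      exact (main.2.subset (show v ∈ _ from ⟨hvm, hvx⟩)).2
    · intro hvx
      exact (main.1.subset (show v ∈ _ from ⟨hvm, hvx⟩)).2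
  · intro h
    obtain ⟨φ, hφ⟩ := h.exists_layout
    refine le_antisymm (iInf_le_of_le φ (iSup_le fun i => ?_)) (one_le_dnw G)
    rw [Set.encard_le_one_iff]
    rintro _ _ ⟨x, hx, rfl⟩ ⟨y, hy, rfl⟩
    refine Prod.ext (Set.ext fun z => ?_) (Set.ext fun z => ?_)
    · exact and_congr_right fun hz => (hφ x y z (lt_of_le_of_lt hx hz) (lt_of_le_of_lt hy hz)).2
    · exact and_congr_right fun hz => (hφ x y z (lt_of_le_of_lt hx hz) (lt_of_le_of_lt hy hz)).1

/-! ### Linear NLC-width one -/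

instance : IsEmpty (LinNLCExpr 0) :=
  ⟨fun X => by
    induction X with
    | single a => exact a.elim0
    | insertVertex _ _ _ a => exact a.elim0
    | relabel _ _ ih => exact ih⟩

theorem dlnlcw_eq_one_iff {V : Type u} [Fintype V] [Nonempty V] (G : Digraph V)
    (loopless : ∀ x, ¬ G.Adj x x) : dlnlcw G = 1 ↔ Dismantlable G.Adj := by
  constructor
  · intro h
    by_contra hG
    have : (2 : ℕ∞) ≤ dlnlcw G := by
      refine le_iInf₂ fun k hk => ?_
      obtain ⟨X, e⟩ := hk
      match k, X, e with
      | 0, X, _ => exact isEmptyElim X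
      | 1, X, e => exact (hG ((Dismantlable.of_linNLCExpr X).of_iso e)).elim
      | k + 2, _, _ => exact_mod_cast Nat.le_add_left 2 k
    rw [h] at this
    exact absurd this (by decide)
  · intro h
    refine le_antisymm (iInf₂_le_of_le 1 (h.exists_linNLCExpr loopless) le_rfl) ?_
    refine le_iInf₂ fun k hk => ?_
    obtain ⟨X, e⟩ := hk
    match k, X, e with
    | 0, X, _ => exact isEmptyElim X
    | k + 1, _, _ => exact_mod_cast Nat.le_add_left 1 k

theorem Dismantlable.dlcw_le_two {V : Type u} [Fintype V] [Nonempty V] {G : Digraph V}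
    (hG : Dismantlable G.Adj) (loopless : ∀ x, ¬ G.Adj x x) : dlcw G ≤ 2 :=
  iInf₂_le_of_le 2 (hG.exists_linCWExpr loopless) le_rfl

/-! ### Linear clique-width two -/

/-- Every nonempty vertex set `S` has a vertex `v` whose neighbours in `S` are joined to it in the
same way, and at least in this way to the non-neighbours of `v` in `S`. -/
def WeaklyDismantlable {V : Type u} (r : V → V → Prop) : Prop :=
  ∀ S : Set V, S.Nonempty → ∃ v ∈ S, ∀ x ∈ S, ∀ y ∈ S, x ≠ v → y ≠ v →
    (r v y → r v x ∨ (¬ r x v ∧ r x y)) ∧ (r y v → r x v ∨ (¬ r v x ∧ r y x))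

theorem WeaklyDismantlable.comap {V : Type u} {W : Type v} {r : V → V → Prop} {s : W → W → Prop}
    (hr : WeaklyDismantlable r) (f : W → V) (hf : Function.Injective f)
    (h : ∀ x y, s x y ↔ r (f x) (f y)) : WeaklyDismantlable s := by
  rintro S hS
  obtain ⟨_, ⟨v, hv, rfl⟩, hom⟩ := hr (f '' S) (hS.image f)
  refine ⟨v, hv, fun x hx y hy hxv hyv => ?_⟩
  simpa only [h] using hom (f x) ⟨x, hx, rfl⟩ (f y) ⟨y, hy, rfl⟩ (hf.ne hxv) (hf.ne hyv)

/-- In a labeled digraph defined with two labels, the last created vertex `v` of a vertex set `S`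
splits the others into a set `P` of vertices that will always be treated like `v` and the rest,
which is joined to `v` uniformly. -/
theorem LinCWExpr.exists_split {k : ℕ} (hk : k ≤ 2) (X : LinCWExpr k) (S : Set X.val.Vert)
    (hS : S.Nonempty) :
    ∃ v ∈ S, ∃ P : Set X.val.Vert,
      (∀ x ∈ S, x ≠ v → x ∈ P →
        X.val.lab x = X.val.lab v ∧ ¬ X.val.graph.Adj v x ∧ ¬ X.val.graph.Adj x v) ∧
      (∀ x ∈ S, ∀ y ∈ S, x ≠ v → y ≠ v → x ∉ P → y ∉ P →
        X.val.lab x = X.val.lab y ∧ (X.val.graph.Adj v x ↔ X.val.graph.Adj v y) ∧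
          (X.val.graph.Adj x v ↔ X.val.graph.Adj y v)) ∧
      (∀ x ∈ S, ∀ y ∈ S, x ≠ v → y ≠ v → x ∈ P → y ∉ P →
        (X.val.graph.Adj v y → X.val.graph.Adj x y) ∧
          (X.val.graph.Adj y v → X.val.graph.Adj y x)) := by
  induction X with
  | single a =>
    obtain ⟨v, hv⟩ := hS
    exact ⟨v, hv, ∅, fun x _ hx => (hx rfl).elim, fun x _ y _ hx => (hx rfl).elim,
      fun x _ y _ hx => (hx rfl).elim⟩
  | addVertex X a ih =>
    by_cases h : Sum.inr () ∈ S
    -- `P` collects the vertices that share the label of `v` at its creation. With at most two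
    -- labels, the vertices outside `P` then share a label as well.
    · refine ⟨.inr (), h, {x | (X.addVertex a).val.lab x = a}, ?_, ?_, ?_⟩
      · rintro (x | x) _ hx hxP
        · exact ⟨hxP, id, id⟩
        · exact (hx rfl).elim
      · rintro (x | x) _ (y | y) _ hx hy hxP hyP
        · refine ⟨?_, Iff.rfl, Iff.rfl⟩
          have h1 : (X.val.lab x : ℕ) ≠ a := fun h => hxP (Fin.ext h)
          have h2 : (X.val.lab y : ℕ) ≠ a := fun h => hyP (Fin.ext h)
          refine Fin.ext (?_ : (X.val.lab x : ℕ) = X.val.lab y)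
          omega
        · exact (hy rfl).elim
        · exact (hx rfl).elim
        · exact (hx rfl).elim
      · rintro x _ (y | y) _ hx hy _ _
        · exact ⟨False.elim, False.elim⟩
        · exact (hy rfl).elim
    · have key : ∀ y ∈ S, ∃ x, Sum.inl x = y := by
        rintro (y | y) hy
        exacts [⟨y, rfl⟩, (h hy).elim]
      obtain ⟨y, hy⟩ := hS
      obtain ⟨x, rfl⟩ := key y hy
      obtain ⟨v, hv, P, h1, h2, h3⟩ := ih {x | Sum.inl x ∈ S} ⟨x, hy⟩
      have inj : ∀ x y : X.val.Vert, (Sum.inl x : X.val.Vert ⊕ Unit) ≠ Sum.inl y → x ≠ y :=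
        fun x y h h' => h (congrArg _ h')
      refine ⟨.inl v, hv, Sum.inl '' P, ?_, ?_, ?_⟩
      · rintro x hx hxv ⟨x, hxP, rfl⟩
        exact h1 x hx (inj _ _ hxv) hxP
      · intro x hx y hy hxv hyv hxP hyP
        obtain ⟨x, rfl⟩ := key x hx
        obtain ⟨y, rfl⟩ := key y hy
        exact h2 x hx y hy (inj _ _ hxv) (inj _ _ hyv) (fun h => hxP ⟨x, h, rfl⟩)
          (fun h => hyP ⟨y, h, rfl⟩)
      · rintro x hx y hy hxv hyv ⟨x, hxP, rfl⟩ hyP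
        obtain ⟨y, rfl⟩ := key y hy
        exact h3 x hx y hy (inj _ _ hxv) (inj _ _ hyv) hxP (fun h => hyP ⟨y, h, rfl⟩)
  | addArcs X a b hab ih =>
    obtain ⟨v, hv, P, h1, h2, h3⟩ := ih S hS
    refine ⟨v, hv, P, ?_, ?_, ?_⟩
    · intro x hx hxv hxP
      obtain ⟨e, n1, n2⟩ := h1 x hx hxv hxP
      refine ⟨e, ?_, ?_⟩
      -- Equal labels exclude a new arc, since arcs are inserted only between distinct labels.
      · rintro (h | ⟨ha, hb⟩)
        · exact n1 h
        · exact hab (ha.symm.trans (e.symm.trans hb))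
      · rintro (h | ⟨ha, hb⟩)
        · exact n2 h
        · exact hab (ha.symm.trans (e.trans hb))
    · intro x hx y hy hxv hyv hxP hyP
      obtain ⟨e, n1, n2⟩ := h2 x hx y hy hxv hyv hxP hyP
      exact ⟨e, or_congr n1 (by rw [e]), or_congr n2 (by rw [e])⟩
    · intro x hx y hy hxv hyv hxP hyP
      obtain ⟨n1, n2⟩ := h3 x hx y hy hxv hyv hxP hyP
      have e := (h1 x hx hxv hxP).1
      exact ⟨Or.imp n1 (by rw [e]; exact id), Or.imp n2 (by rw [e]; exact id)⟩
  | relabel X a b ih =>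
    obtain ⟨v, hv, P, h1, h2, h3⟩ := ih S hS
    refine ⟨v, hv, P, ?_, ?_, h3⟩
    · intro x hx hxv hxP
      obtain ⟨e, n⟩ := h1 x hx hxv hxP
      exact ⟨congrArg (fun c => if c = a then b else c) e, n⟩
    · intro x hx y hy hxv hyv hxP hyP
      obtain ⟨e, n⟩ := h2 x hx y hy hxv hyv hxP hyP
      exact ⟨congrArg (fun c => if c = a then b else c) e, n⟩

/-- Membership in `P` is eliminated: a vertex of `P` has no arc with `v` and inherits all arcs of
`v` to vertices outside `P`. The result mentions only the adjacency relation, so it restricts to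
induced subdigraphs and can be tested on a given digraph. -/
theorem LinCWExpr.weaklyDismantlable {k : ℕ} (hk : k ≤ 2) (X : LinCWExpr k) :
    WeaklyDismantlable X.val.graph.Adj := by
  intro S hS
  obtain ⟨v, hv, P, h1, h2, h3⟩ := X.exists_split hk S hS
  refine ⟨v, hv, fun x hx y hy hxv hyv => ?_⟩
  by_cases hxP : x ∈ P <;> by_cases hyP : y ∈ P
  · have a := h1 y hy hyv hyP
    exact ⟨fun h => (a.2.1 h).elim, fun h => (a.2.2 h).elim⟩
  · have a := h1 x hx hxv hxP
    have b := h3 x hx y hy hxv hyv hxP hyP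
    exact ⟨fun h => .inr ⟨a.2.2, b.1 h⟩, fun h => .inr ⟨a.2.1, b.2 h⟩⟩
  · have a := h1 y hy hyv hyP
    exact ⟨fun h => (a.2.1 h).elim, fun h => (a.2.2 h).elim⟩
  · have a := h2 x hx y hy hxv hyv hxP hyP
    exact ⟨fun h => .inl (a.2.1.mpr h), fun h => .inl (a.2.2.mpr h)⟩

theorem weaklyDismantlable_of_dlcw_le_two {V : Type u} {G : Digraph V} (h : dlcw G ≤ 2) :
    WeaklyDismantlable G.Adj := by
  by_contra hG
  have : (3 : ℕ∞) ≤ dlcw G := by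
    refine le_iInf₂ fun k hk => ?_
    obtain ⟨X, ⟨e⟩⟩ := hk
    by_contra hk
    have hk : k ≤ 2 := by
      have : (k : ℕ∞) < (3 : ℕ) := not_le.mp hk
      exact Nat.lt_succ_iff.mp (by exact_mod_cast this)
    exact hG ((X.weaklyDismantlable hk).comap e.symm e.symm.injective
      fun x y => (e.symm.map_rel_iff).symm)
  exact absurd (this.trans h) (by decide)

/-! ### Excluding the forbidden digraphs -/

theorem Free.mono {V : Type u} {F F' : Set FinDigraph} {G : Digraph V} (h : Free F G)
    (hF : F' ⊆ F) : Free F' G := fun H hH => h H (hF hH)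

theorem Free.of_subset_union {V : Type u} {F F' F'' : Set FinDigraph} {G : Digraph V}
    (h : Free F G) (h' : Free F' G) (hF : F'' ⊆ F ∪ F') : Free F'' G :=
  fun H hH => (hF hH).elim (h H) (h' H)

theorem Free.not_embedding {V : Type u} {F : Set FinDigraph} {G : Digraph V} (h : Free F G)
    {H : FinDigraph} (hH : H ∈ F) (f : Fin H.1 → V) (hf : Function.Injective f)
    (hadj : ∀ x y, G.Adj (f x) (f y) ↔ H.2.Adj x y) : False := by
  refine h H hH (Set.range f) ⟨RelIso.symm ⟨Equiv.ofInjective f hf, ?_⟩⟩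
  intro x y
  exact hadj x y

theorem free_of_forall_not_embedding {V : Type u} {F : Set FinDigraph} {G : Digraph V}
    (h : ∀ H ∈ F, ∀ f : Fin H.1 → V, Function.Injective f →
      ¬ ∀ x y, H.2.Adj x y ↔ G.Adj (f x) (f y)) : Free F G := by
  rintro H hH s ⟨e⟩
  exact h H hH (fun x => e.symm x) (Subtype.val_injective.comp e.symm.injective)
    fun x y => (e.symm.map_rel_iff).symm

/-- Testing the full vertex set is enough: no forbidden digraph has a homogeneous vertex. -/
theorem not_dismantlable_of_forall {V : Type u} [Nonempty V] {r : V → V → Prop}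
    (h : ∀ v, ∃ x y, x ≠ v ∧ y ≠ v ∧ ¬ ((r v x → r v y) ∧ (r x v → r y v))) :
    ¬ Dismantlable r := by
  intro hr
  obtain ⟨v, -, hv⟩ := hr Set.univ Set.univ_nonempty
  obtain ⟨x, y, hx, hy, hn⟩ := h v
  exact hn (hv x trivial y trivial hx hy)

theorem not_weaklyDismantlable_of_forall {V : Type u} [Nonempty V] {r : V → V → Prop}
    (h : ∀ v, ∃ x y, x ≠ v ∧ y ≠ v ∧
      ¬ ((r v y → r v x ∨ (¬ r x v ∧ r x y)) ∧ (r y v → r x v ∨ (¬ r v x ∧ r y x)))) :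
    ¬ WeaklyDismantlable r := by
  intro hr
  obtain ⟨v, -, hv⟩ := hr Set.univ Set.univ_nonempty
  obtain ⟨x, y, hx, hy, hn⟩ := h v
  exact hn (hv x trivial y trivial hx hy)

set_option synthInstance.maxHeartbeats 200000 in
set_option synthInstance.maxSize 2000 in
theorem not_dismantlable_ofArcs {n : ℕ} [NeZero n] {A : List (Fin n × Fin n)}
    (h : decide (∀ v : Fin n, ∃ x y, x ≠ v ∧ y ≠ v ∧
      ¬ (((v, x) ∈ A → (v, y) ∈ A) ∧ ((x, v) ∈ A → (y, v) ∈ A))) = true) :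
    ¬ Dismantlable (ofArcs n A).2.Adj :=
  @not_dismantlable_of_forall (Fin n) _ (fun x y => (x, y) ∈ A) (of_decide_eq_true h)

set_option synthInstance.maxHeartbeats 200000 in
set_option synthInstance.maxSize 2000 in
theorem not_weaklyDismantlable_ofArcs {n : ℕ} [NeZero n] {A : List (Fin n × Fin n)}
    (h : decide (∀ v : Fin n, ∃ x y, x ≠ v ∧ y ≠ v ∧
      ¬ (((v, y) ∈ A → (v, x) ∈ A ∨ (¬ (x, v) ∈ A ∧ (x, y) ∈ A)) ∧
        ((y, v) ∈ A → (x, v) ∈ A ∨ (¬ (v, x) ∈ A ∧ (y, x) ∈ A)))) = true) :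
    ¬ WeaklyDismantlable (ofArcs n A).2.Adj :=
  @not_weaklyDismantlable_of_forall (Fin n) _ (fun x y => (x, y) ∈ A) (of_decide_eq_true h)

theorem Dismantlable.free {V : Type u} {G : Digraph V} (hG : Dismantlable G.Adj) :
    Free {D1, D2, D3, D4, D5, D6, D7, D8, D9, D10, D11, D12, D13, D14, D15,
      twoDirP2, dirP2BiP2, twoBiP2} G := by
  refine free_of_forall_not_embedding fun H hH f hf h => ?_
  have key := hG.comap f hf h
  simp only [Set.mem_insert_iff, Set.mem_singleton_iff] at hH
  rcases hH with rfl | rfl | rfl | rfl | rfl | rfl | rfl | rfl | rfl | rfl | rfl | rfl | rfl |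
    rfl | rfl | rfl | rfl | rfl
  iterate 5 exact not_dismantlable_ofArcs (n := 3) (by decide) key
  iterate 13 exact not_dismantlable_ofArcs (n := 4) (by decide) key

/-- These eleven and the seven digraphs of statement 3 together make up the full list of eighteen.
-/
theorem WeaklyDismantlable.free {V : Type u} {G : Digraph V} (hG : WeaklyDismantlable G.Adj) :
    Free {D1, D4, D5, D6, D7, D8, D11, D15, twoDirP2, dirP2BiP2, twoBiP2} G := by
  refine free_of_forall_not_embedding fun H hH f hf h => ?_
  have key := hG.comap f hf h
  simp only [Set.mem_insert_iff, Set.mem_singleton_iff] at hH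
  rcases hH with rfl | rfl | rfl | rfl | rfl | rfl | rfl | rfl | rfl | rfl | rfl
  iterate 3 exact not_weaklyDismantlable_ofArcs (n := 3) (by decide) key
  iterate 8 exact not_weaklyDismantlable_ofArcs (n := 4) (by decide) key

theorem Dismantlable.un {V : Type u} {G : Digraph V} (hG : Dismantlable G.Adj) :
    Dismantlable (un G).Adj := by
  intro S hS
  obtain ⟨v, hv, hom⟩ := hG S hS
  refine ⟨v, hv, fun x hx y hy hxv hyv => ?_⟩
  have := hom x hx y hy hxv hyv
  simp only [Digraph.toSimpleGraphInclusive, SimpleGraph.fromRel_adj] at *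
  grind

theorem Dismantlable.freeP4TwoK2C4 {V : Type u} {G : SimpleGraph V} (hG : Dismantlable G.Adj) :
    FreeP4TwoK2C4 G := by
  refine ⟨?_, ?_, ?_⟩
  · rintro ⟨f⟩
    exact not_dismantlable_of_forall (by simp only [SimpleGraph.pathGraph_adj]; decide)
      (hG.comap f f.injective fun x y => f.map_rel_iff.symm)
  · rintro ⟨f⟩
    refine not_dismantlable_of_forall ?_ (hG.comap f f.injective fun x y => f.map_rel_iff.symm)
    simp only [Sum.forall, Sum.exists, SimpleGraph.sum_adj_inl, SimpleGraph.sum_adj_inr,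
      SimpleGraph.top_adj]
    simp [Fin.forall_fin_two]
  · rintro ⟨f⟩
    refine not_dismantlable_of_forall ?_ (hG.comap f f.injective fun x y => f.map_rel_iff.symm)
    decide

/-! ### Alternating 4-cycles and tournaments -/

/-- A symmetric relation without alternating 4-cycles has an isolated or a dominating element. -/
theorem exists_isolated_or_dominating {V : Type u} [Finite V] {r : V → V → Prop}
    (symm : ∀ x y, r x y → r y x)
    (S : Set V) (hS : S.Nonempty)
    (alt : ∀ u ∈ S, ∀ a ∈ S, ∀ v ∈ S, ∀ b ∈ S, u ≠ b → v ≠ a → r u a → r v b → r u b ∨ r v a) :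
    ∃ v ∈ S, (∀ x ∈ S, x ≠ v → ¬ r v x) ∨ (∀ x ∈ S, x ≠ v → r v x) := by
  classical
  by_contra! H
  have : Fintype V := Fintype.ofFinite V
  -- Take `u` of maximum degree in `S`, a non-neighbour `b` of `u`, and a neighbour `v` of `b`. The
  -- hypothesis `alt` makes every neighbour of `u` other than `v` a neighbour of `v`, while `b` is a
  -- neighbour of `v` only. Hence `v` has larger degree than `u`.
  obtain ⟨u, hu, hmax⟩ := Set.exists_max_image S
    (fun v => (Finset.univ.filter fun x => x ∈ S ∧ x ≠ v ∧ r v x).card) S.toFinite hS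
  obtain ⟨b, hb, hbu, hub⟩ := (H u hu).2
  obtain ⟨v, hv, hvb, hbv⟩ := (H b hb).1
  have hvb' := symm _ _ hbv
  have huv : u ≠ v := by rintro rfl; exact hub hvb'
  have sub : ∀ a ∈ S, a ≠ u → r u a → a ≠ v → r v a := fun a ha hau hua hav =>
    (alt u hu a ha v hv b hb hbu.symm hav.symm hua hvb').resolve_left hub
  refine absurd (hmax v hv) (not_le.mpr ?_)
  -- If `u` and `v` are adjacent, each counts once for the other, and `b` remains as the surplus of
  -- `v`.
  by_cases hr : r u v
  · have h1 : (Finset.univ.filter fun x => x ∈ S ∧ x ≠ u ∧ r u x) ⊆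
        insert v ((Finset.univ.filter fun x => x ∈ S ∧ x ≠ v ∧ r v x).erase u |>.erase b) := by
      intro a ha
      simp only [Finset.mem_filter, Finset.mem_univ, true_and, Finset.mem_insert,
        Finset.mem_erase] at ha ⊢
      by_cases hav : a = v
      · exact .inl hav
      · exact .inr ⟨by rintro rfl; exact hub ha.2.2, ha.2.1, ha.1, hav, sub a ha.1 ha.2.1 ha.2.2 hav⟩
    have h2 := (Finset.card_le_card h1).trans (Finset.card_insert_le _ _)
    have hu' : u ∈ Finset.univ.filter fun x => x ∈ S ∧ x ≠ v ∧ r v x := by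
      simp [hu, huv, symm _ _ hr]
    have hb' : b ∈ (Finset.univ.filter fun x => x ∈ S ∧ x ≠ v ∧ r v x).erase u := by
      simp [hb, hbu, hvb.symm, hvb']
    have h3 := Finset.card_erase_add_one hb'
    have h4 := Finset.card_erase_add_one hu'
    omega
  · refine Finset.card_lt_card ⟨?_, ?_⟩
    · intro a ha
      simp only [Finset.mem_filter, Finset.mem_univ, true_and] at ha ⊢
      have hav : a ≠ v := by rintro rfl; exact hr ha.2.2
      exact ⟨ha.1, hav, sub a ha.1 ha.2.1 ha.2.2 hav⟩
    · intro h
      have : b ∈ Finset.univ.filter fun x => x ∈ S ∧ x ≠ u ∧ r u x :=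
        h (by simp [hb, hvb.symm, hvb'])
      simp only [Finset.mem_filter] at this
      exact hub this.2.2.2

/-- A finite tournament without directed triangles has a source. -/
theorem exists_source {V : Type u} [Finite V] {r : V → V → Prop} (S : Set V) (hS : S.Nonempty)
    (irrefl : ∀ x, ¬ r x x)
    (total : ∀ x ∈ S, ∀ y ∈ S, x ≠ y → r x y ∨ r y x)
    (trans : ∀ x ∈ S, ∀ y ∈ S, ∀ z ∈ S, r x y → r y z → r x z) :
    ∃ v ∈ S, ∀ x ∈ S, x ≠ v → r v x := by
  let rS : S → S → Prop := fun x y => r x y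
  have : IsTrans S rS := ⟨fun x y z => trans x x.2 y y.2 z z.2⟩
  have : Std.Irrefl rS := ⟨fun x => irrefl x⟩
  have wf : WellFounded rS := Finite.wellFounded_of_trans_of_irrefl rS
  obtain ⟨v, -, hv⟩ := wf.has_min Set.univ ⟨⟨_, hS.some_mem⟩, trivial⟩
  exact ⟨v, v.2, fun x hx hxv => (total x hx v v.2 hxv).resolve_left (hv ⟨x, hx⟩ trivial)⟩

/-! ### The graph of single arcs -/

/-- Exactly one arc joins `x` and `y`. -/
def SingleArc {V : Type u} (G : Digraph V) (x y : V) : Prop :=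
  (G.Adj x y ∧ ¬ G.Adj y x) ∨ (G.Adj y x ∧ ¬ G.Adj x y)

theorem SingleArc.symm {V : Type u} {G : Digraph V} {x y : V} (h : SingleArc G x y) :
    SingleArc G y x := Or.symm h

/-- The class of digraphs without induced subdigraphs from the full list. -/
abbrev ThresholdFree {V : Type u} (G : Digraph V) : Prop :=
  Free {D1, D2, D3, D4, D5, D6, D7, D8, D9, D10, D11, D12, D13, D14, D15,
      twoDirP2, dirP2BiP2, twoBiP2} G

section
variable {V : Type u} {G : Digraph V}

theorem Free.not_three {F : Set FinDigraph} {A : List (Fin 3 × Fin 3)} (h : Free F G)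
    (hF : ofArcs 3 A ∈ F) {a b c : V} (hab : a ≠ b) (hac : a ≠ c) (hbc : b ≠ c)
    (H : ∀ i j : Fin 3, G.Adj (![a, b, c] i) (![a, b, c] j) ↔ (i, j) ∈ A) : False := by
  have inj : ∀ i j : Fin 3, ![a, b, c] i = ![a, b, c] j → i = j := by
    simp [Fin.forall_fin_succ, hab, hac, hbc, hab.symm, hac.symm, hbc.symm]
  exact h.not_embedding hF ![a, b, c] inj H

theorem Free.not_four {F : Set FinDigraph} {A : List (Fin 4 × Fin 4)} (h : Free F G)
    (hF : ofArcs 4 A ∈ F) {a b c d : V} (hab : a ≠ b) (hac : a ≠ c) (had : a ≠ d) (hbc : b ≠ c)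
    (hbd : b ≠ d) (hcd : c ≠ d)
    (H : ∀ i j : Fin 4, G.Adj (![a, b, c, d] i) (![a, b, c, d] j) ↔ (i, j) ∈ A) : False := by
  have inj : ∀ i j : Fin 4, ![a, b, c, d] i = ![a, b, c, d] j → i = j := by
    simp [Fin.forall_fin_succ, hab, hac, had, hbc, hbd, hcd, hab.symm, hac.symm, had.symm,
      hbc.symm, hbd.symm, hcd.symm]
  exact h.not_embedding hF ![a, b, c, d] inj H

theorem SingleArc.ne {x y : V} (h : SingleArc G x y) : x ≠ y := by
  rintro rfl
  rcases h with h | h <;> exact h.2 h.1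

theorem SingleArc.adj_comm {x y : V} (h : SingleArc G x y) : G.Adj y x ↔ ¬ G.Adj x y := by
  rcases h with h | h <;> simp [h]

theorem not_singleArc_iff {x y : V} : ¬ SingleArc G x y ↔ (G.Adj x y ↔ G.Adj y x) := by
  unfold SingleArc
  tauto

/-- Opposite directions at `z` would form a directed path through `z` whose ends are non-adjacent
(`D1`) or joined both ways (`D4`). -/
theorem ThresholdFree.adj_iff_of_singleArc (hG : ThresholdFree G) (loopless : ∀ x, ¬ G.Adj x x)
    {x y z : V} (hx : SingleArc G z x)
    (hy : SingleArc G z y) (hxy : x ≠ y) (hn : ¬ SingleArc G x y) :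
    G.Adj z x ↔ G.Adj z y := by
  have aux : ∀ x y : V, SingleArc G z x → SingleArc G z y → x ≠ y → ¬ SingleArc G x y →
      G.Adj z x → ¬ G.Adj z y → False := by
    intro x y hx hy hxy hn h1 h2
    have h3 := hx.adj_comm
    have h4 := hy.adj_comm
    rw [not_singleArc_iff] at hn
    by_cases h5 : G.Adj x y
    · refine hG.not_three (show D4 ∈ _ by simp) hy.ne.symm hxy.symm hx.ne ?_
      simp_all [Fin.forall_fin_succ]
    · refine hG.not_three (show D1 ∈ _ by simp) hy.ne.symm hxy.symm hx.ne ?_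
      simp_all [Fin.forall_fin_succ]
  have hn' : ¬ SingleArc G y x := fun h => hn h.symm
  exact ⟨fun h => by_contra fun h' => aux x y hx hy hxy hn h h',
    fun h => by_contra fun h' => aux y x hy hx hxy.symm hn' h h'⟩

/-- If `z` were joined both ways to one end of the single arc and non-adjacent to the other, the
three vertices would induce `D2` or `D3`, according to the direction of that arc. -/
theorem ThresholdFree.adj_iff_of_not_singleArc (hG : ThresholdFree G) (loopless : ∀ x, ¬ G.Adj x x)
    {x y z : V} (hxy : SingleArc G x y)
    (hzx : z ≠ x) (hzy : z ≠ y) (hx : ¬ SingleArc G z x) (hy : ¬ SingleArc G z y) :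
    G.Adj z x ↔ G.Adj z y := by
  have aux : ∀ x y : V, SingleArc G x y → z ≠ x → z ≠ y → ¬ SingleArc G z x →
      ¬ SingleArc G z y → G.Adj z x → ¬ G.Adj z y → False := by
    intro x y hxy hzx hzy hx hy h1 h2
    have h3 := hxy.adj_comm
    rw [not_singleArc_iff] at hx hy
    by_cases h5 : G.Adj x y
    · refine hG.not_three (show D3 ∈ _ by simp) hxy.ne.symm hzy.symm hzx.symm ?_
      simp_all [Fin.forall_fin_succ]
    · refine hG.not_three (show D2 ∈ _ by simp) hxy.ne.symm hzy.symm hzx.symm ?_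
      simp_all [Fin.forall_fin_succ]
  exact ⟨fun h => by_contra fun h' => aux x y hxy hzx hzy hx hy h h',
    fun h => by_contra fun h' => aux y x hxy.symm hzy hzx hy hx h h'⟩

theorem ThresholdFree.adj_trans (hG : ThresholdFree G) (loopless : ∀ x, ¬ G.Adj x x)
    {x y z : V} (hxy : SingleArc G x y) (hyz : SingleArc G y z)
    (hxz : SingleArc G x z) (h1 : G.Adj x y) (h2 : G.Adj y z) : G.Adj x z := by
  by_contra h3
  have h4 := hxy.adj_comm
  have h5 := hyz.adj_comm
  have h6 := hxz.adj_comm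
  refine hG.not_three (show D5 ∈ _ by simp) hxy.ne hxz.ne hyz.ne ?_
  simp_all [Fin.forall_fin_succ]

/-- An induced 2K₂ of single arcs has all four cross pairs of one type: both arcs give `D11`, none
gives `twoDirP2`. -/
theorem ThresholdFree.not_two_arcs (hG : ThresholdFree G) (loopless : ∀ x, ¬ G.Adj x x)
    {a b c d : V} (hab : SingleArc G a b) (hcd : SingleArc G c d)
    (h1 : G.Adj a b) (h2 : G.Adj c d) (hac : a ≠ c) (had : a ≠ d) (hbc : b ≠ c) (hbd : b ≠ d)
    (nac : ¬ SingleArc G a c) (nad : ¬ SingleArc G a d) (nbc : ¬ SingleArc G b c)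
    (nbd : ¬ SingleArc G b d) : False := by
  have e1 := hG.adj_iff_of_not_singleArc loopless hcd hac had nac nad
  have e2 := hG.adj_iff_of_not_singleArc loopless hcd hbc hbd nbc nbd
  have e3 := hG.adj_iff_of_not_singleArc loopless hab hac.symm hbc.symm (fun h => nac h.symm)
    (fun h => nbc h.symm)
  have h3 := hab.adj_comm
  have h4 := hcd.adj_comm
  have hab' := hab.ne
  have hcd' := hcd.ne
  rw [not_singleArc_iff] at nac nad nbc nbd
  by_cases h5 : G.Adj a c
  · refine hG.not_four (show D11 ∈ _ by simp) hab' hac had hbc hbd hcd' ?_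
    simp_all [Fin.forall_fin_succ]
  · refine hG.not_four (show twoDirP2 ∈ _ by simp) hab' hac had hbc hbd hcd' ?_
    simp_all [Fin.forall_fin_succ]

/-- Along an induced P₄ of single arcs the directions alternate, and the three other pairs are of
one type: both arcs give `D6`, none gives `D7`. -/
theorem ThresholdFree.not_path (hG : ThresholdFree G) (loopless : ∀ x, ¬ G.Adj x x)
    {a b c d : V} (hab : SingleArc G a b) (hbc : SingleArc G b c)
    (hcd : SingleArc G c d) (hac : a ≠ c) (had : a ≠ d) (hbd : b ≠ d)
    (nac : ¬ SingleArc G a c) (nad : ¬ SingleArc G a d) (nbd : ¬ SingleArc G b d) : False := by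
  have aux : ∀ a b c d : V, SingleArc G a b → SingleArc G b c → SingleArc G c d →
      a ≠ c → a ≠ d → b ≠ d → ¬ SingleArc G a c → ¬ SingleArc G a d → ¬ SingleArc G b d →
      G.Adj a b → False := by
    intro a b c d hab hbc hcd hac had hbd nac nad nbd h
    have e1 := hG.adj_iff_of_singleArc loopless hab.symm hbc hac nac
    have e2 := hG.adj_iff_of_singleArc loopless hbc.symm hcd hbd nbd
    have e3 := hG.adj_iff_of_not_singleArc loopless hab had.symm hbd.symm (fun h => nad h.symm)
      (fun h => nbd h.symm)
    have e4 := hG.adj_iff_of_not_singleArc loopless hcd hac had nac nad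
    have h1 := hab.adj_comm
    have h2 := hbc.adj_comm
    have h3 := hcd.adj_comm
    rw [not_singleArc_iff] at nac nad nbd
    by_cases h5 : G.Adj a c
    · refine hG.not_four (show D6 ∈ _ by simp) hab.ne hac had hbc.ne hbd hcd.ne ?_
      simp_all [Fin.forall_fin_succ]
    · refine hG.not_four (show D7 ∈ _ by simp) hab.ne hac had hbc.ne hbd hcd.ne ?_
      simp_all [Fin.forall_fin_succ]
  by_cases h : G.Adj a b
  · exact aux a b c d hab hbc hcd hac had hbd nac nad nbd h
  -- By alternation, the path read from `d` starts with a forward arc.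
  · have e1 := hG.adj_iff_of_singleArc loopless hab.symm hbc hac nac
    have e2 := hG.adj_iff_of_singleArc loopless hbc.symm hcd hbd nbd
    have h1 := hab.adj_comm
    have h2 := hbc.adj_comm
    have h3 := hcd.adj_comm
    exact aux d c b a hcd.symm hbc.symm hab.symm hbd.symm had.symm hac.symm
      (fun h => nbd h.symm) (fun h => nad h.symm) (fun h => nac h.symm) (by tauto)

/-- In an induced C₄ of single arcs, one diagonal pair consists of sources and the other of sinks.
The types of the two diagonals select one of `D12` to `D15`. -/
theorem ThresholdFree.not_cycle (hG : ThresholdFree G) (loopless : ∀ x, ¬ G.Adj x x)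
    {a b c d : V} (hab : SingleArc G a b) (hbc : SingleArc G b c)
    (hcd : SingleArc G c d) (hda : SingleArc G d a) (hac : a ≠ c) (hbd : b ≠ d)
    (nac : ¬ SingleArc G a c) (nbd : ¬ SingleArc G b d) : False := by
  have aux : ∀ a b c d : V, SingleArc G a b → SingleArc G b c → SingleArc G c d →
      SingleArc G d a → a ≠ c → b ≠ d → ¬ SingleArc G a c → ¬ SingleArc G b d →
      G.Adj a b → False := by
    intro a b c d hab hbc hcd hda hac hbd nac nbd h
    have e1 := hG.adj_iff_of_singleArc loopless hab.symm hbc hac nac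
    have e2 := hG.adj_iff_of_singleArc loopless hbc.symm hcd hbd nbd
    have e3 := hG.adj_iff_of_singleArc loopless hcd.symm hda hac.symm (fun h => nac h.symm)
    have h1 := hab.adj_comm
    have h2 := hbc.adj_comm
    have h3 := hcd.adj_comm
    have h4 := hda.adj_comm
    rw [not_singleArc_iff] at nac nbd
    by_cases h5 : G.Adj a c <;> by_cases h6 : G.Adj b d
    · refine hG.not_four (show D15 ∈ _ by simp) hac hab.ne hda.ne.symm hbc.ne.symm hcd.ne hbd ?_
      simp_all [Fin.forall_fin_succ]
    · refine hG.not_four (show D14 ∈ _ by simp) hac hab.ne hda.ne.symm hbc.ne.symm hcd.ne hbd ?_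
      simp_all [Fin.forall_fin_succ]
    · refine hG.not_four (show D13 ∈ _ by simp) hac hab.ne hda.ne.symm hbc.ne.symm hcd.ne hbd ?_
      simp_all [Fin.forall_fin_succ]
    · refine hG.not_four (show D12 ∈ _ by simp) hac hab.ne hda.ne.symm hbc.ne.symm hcd.ne hbd ?_
      simp_all [Fin.forall_fin_succ]
  by_cases h : G.Adj a b
  · exact aux a b c d hab hbc hcd hda hac hbd nac nbd h
  · exact aux b a d c hab.symm hda.symm hcd.symm hbc.symm hbd hac nbd nac
      (hab.adj_comm.mpr h)

/-- In an alternating 4-cycle the two pairs left open, `u v` and `a b`, decide whether the single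
arcs induce C₄, P₄ or 2K₂, and each is excluded. -/
theorem ThresholdFree.singleArc_alt (hG : ThresholdFree G) (loopless : ∀ x, ¬ G.Adj x x)
    {u a v b : V} (hub : u ≠ b) (hva : v ≠ a)
    (h1 : SingleArc G u a) (h2 : SingleArc G v b) : SingleArc G u b ∨ SingleArc G v a := by
  by_contra! H
  obtain ⟨n1, n2⟩ := H
  have n1' : ¬ SingleArc G b u := fun h => n1 h.symm
  have n2' : ¬ SingleArc G a v := fun h => n2 h.symm
  have huv : u ≠ v := by rintro rfl; exact n1 h2
  have hab : a ≠ b := by rintro rfl; exact n1 h1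
  by_cases h3 : SingleArc G u v <;> by_cases h4 : SingleArc G a b
  · exact hG.not_cycle loopless h1 h4 h2.symm h3.symm hub hva.symm n1 n2'
  · exact hG.not_path loopless h1.symm h3 h2 hva.symm hab hub n2' h4 n1
  · exact hG.not_path loopless h1 h4 h2.symm hub huv hva.symm n1 h3 n2'
  · have h3' : ¬ SingleArc G v u := fun h => h3 h.symm
    have h4' : ¬ SingleArc G b a := fun h => h4 h.symm
    by_cases o1 : G.Adj u a <;> by_cases o2 : G.Adj v b
    · exact hG.not_two_arcs loopless h1 h2 o1 o2 huv hub hva.symm hab h3 n1 n2' h4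
    · exact hG.not_two_arcs loopless h1 h2.symm o1 (h2.adj_comm.mpr o2) hub huv hab hva.symm
        n1 h3 h4 n2'
    · exact hG.not_two_arcs loopless h1.symm h2 (h1.adj_comm.mpr o1) o2 hva.symm hab huv hub
        n2' h4 h3 n1
    · exact hG.not_two_arcs loopless h1.symm h2.symm (h1.adj_comm.mpr o1)
        (h2.adj_comm.mpr o2) hab hva.symm hub huv h4 n2' n1 h3

/-- On a set without single arcs, the arcs form a symmetric relation without alternating
4-cycles. -/
theorem ThresholdFree.adj_alt (hG : ThresholdFree G) (loopless : ∀ x, ¬ G.Adj x x)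
    {S : Set V} (hS : ∀ x ∈ S, ∀ y ∈ S, ¬ SingleArc G x y) {u a v b : V}
    (hu : u ∈ S) (ha : a ∈ S) (hv : v ∈ S) (hb : b ∈ S) (hub : u ≠ b) (hva : v ≠ a)
    (h1 : G.Adj u a) (h2 : G.Adj v b) : G.Adj u b ∨ G.Adj v a := by
  by_contra! H
  obtain ⟨n1, n2⟩ := H
  have huv : u ≠ v := by rintro rfl; exact n1 h2
  have hab : a ≠ b := by rintro rfl; exact n1 h1
  have hua : u ≠ a := by rintro rfl; exact loopless _ h1
  have hvb : v ≠ b := by rintro rfl; exact loopless _ h2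
  have s : ∀ x ∈ S, ∀ y ∈ S, (G.Adj x y ↔ G.Adj y x) := fun x hx y hy =>
    not_singleArc_iff.mp (hS x hx y hy)
  have s1 := s u hu a ha
  have s2 := s v hv b hb
  have s3 := s u hu b hb
  have s4 := s v hv a ha
  have s5 := s u hu v hv
  have s6 := s a ha b hb
  clear s hS
  -- As for single arcs, the two open pairs lead to a bioriented C₄ (`D9`), P₄ (`D8`) or 2K₂
  -- (`twoBiP2`).
  by_cases h3 : G.Adj u v <;> by_cases h4 : G.Adj a b
  · refine hG.not_four (show D9 ∈ _ by simp) hub hua huv hab.symm hvb.symm hva.symm ?_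
    simp_all [Fin.forall_fin_succ]
  · refine hG.not_four (show D8 ∈ _ by simp) hua.symm hva.symm hab huv hub hvb ?_
    simp_all [Fin.forall_fin_succ]
  · refine hG.not_four (show D8 ∈ _ by simp) hua hub huv hab hva.symm hvb.symm ?_
    simp_all [Fin.forall_fin_succ]
  · refine hG.not_four (show twoBiP2 ∈ _ by simp) hua huv hub hva.symm hab hvb ?_
    simp_all [Fin.forall_fin_succ]

/-- Two vertices joined uniformly and symmetrically to the ends of a single arc are joined to each
other in the same way. -/
theorem ThresholdFree.adj_iff_of_joined (hG : ThresholdFree G) (loopless : ∀ x, ¬ G.Adj x x)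
    {x y s t : V} (hst : SingleArc G s t) (hxy : x ≠ y)
    (hxs : x ≠ s) (hxt : x ≠ t) (hys : y ≠ s) (hyt : y ≠ t) {p : Prop}
    (xs : G.Adj x s ↔ p) (sx : G.Adj s x ↔ p) (xt : G.Adj x t ↔ p) (tx : G.Adj t x ↔ p)
    (ys : G.Adj y s ↔ p) (sy : G.Adj s y ↔ p) (yt : G.Adj y t ↔ p) (ty : G.Adj t y ↔ p)
    (n : ¬ SingleArc G x y) : G.Adj x y ↔ p := by
  have h1 := hst.adj_comm
  have hst' := hst.ne
  rw [not_singleArc_iff] at n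
  by_contra H
  -- If `p` holds, `x` and `y` are non-adjacent and `D10` appears; otherwise they are joined both
  -- ways and form `dirP2BiP2` with the single arc.
  by_cases hp : p <;> by_cases h2 : G.Adj s t
  · refine hG.not_four (show D10 ∈ _ by simp) hxy hxs hxt hys hyt hst' ?_
    simp_all [Fin.forall_fin_succ]
  · refine hG.not_four (show D10 ∈ _ by simp) hxy hxt hxs hyt hys hst'.symm ?_
    simp_all [Fin.forall_fin_succ]
  · refine hG.not_four (show dirP2BiP2 ∈ _ by simp) hst' hxs.symm hys.symm hxt.symm hyt.symm hxy ?_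
    simp_all [Fin.forall_fin_succ]
  · refine hG.not_four (show dirP2BiP2 ∈ _ by simp) hst'.symm hxt.symm hyt.symm hxs.symm hys.symm
      hxy ?_
    simp_all [Fin.forall_fin_succ]

end

/-! ### Existence of homogeneous vertices -/

section
variable {V : Type u} {G : Digraph V}

/-- If some vertex of `S` is joined by single arcs to all others, then `S` has a homogeneous
vertex. -/
theorem ThresholdFree.exists_homogeneous_of_dominating [Finite V] (hG : ThresholdFree G)
    (loopless : ∀ x, ¬ G.Adj x x) {S : Set V} {k : V} (hkS : k ∈ S)
    (hk : ∀ x ∈ S, x ≠ k → SingleArc G k x) : ∃ v ∈ S, HomogeneousIn G.Adj S v := by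
  let K : Set V := {v ∈ S | ∀ x ∈ S, x ≠ v → SingleArc G v x}
  have hkK : k ∈ K := ⟨hkS, hk⟩
  -- `T` is the set `K` of dominating vertices with at most one representative `z` of `S \ K`. Since
  -- `z` is in no single arc inside `S \ K`, a vertex of `K` has the same direction to all of `S \
  -- K` as to `z`.
  obtain ⟨T, hTS, hKT, hT, hrep, hsub⟩ : ∃ T ⊆ S, K ⊆ T ∧
      (∀ x ∈ T, ∀ y ∈ T, x ≠ y → SingleArc G x y) ∧
      (∀ v ∈ K, ∀ x ∈ S, x ≠ v → ∃ t ∈ T, t ≠ v ∧ (G.Adj v x ↔ G.Adj v t)) ∧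
      (∀ x ∈ T, ∀ y ∈ T, x ∉ K → y ∉ K → x = y) := by
    by_cases hC : (S \ K).Nonempty
    · obtain ⟨z, hz, h⟩ := exists_isolated_or_dominating (r := SingleArc G)
        (fun _ _ => SingleArc.symm) (S \ K) hC
        (fun u _ a _ v _ b _ => hG.singleArc_alt loopless)
      -- A vertex dominating `S \ K` would dominate `S` and so lie in `K`.
      replace h : ∀ x ∈ S \ K, x ≠ z → ¬ SingleArc G z x := by
        refine h.resolve_right fun h => hz.2 ⟨hz.1, fun x hx hxz => ?_⟩
        by_cases hxK : x ∈ K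
        · exact (hxK.2 z hz.1 hxz.symm).symm
        · exact h x ⟨hx, hxK⟩ hxz
      refine ⟨insert z K, Set.insert_subset hz.1 (fun x hx => hx.1), Set.subset_insert _ _,
        ?_, ?_, ?_⟩
      · rintro x (rfl | hx) y (rfl | hy) hxy
        · exact (hxy rfl).elim
        · exact (hy.2 x hz.1 hxy).symm
        · exact hx.2 y hz.1 hxy.symm
        · exact hx.2 y hy.1 hxy.symm
      · intro v hv x hx hxv
        by_cases hxK : x ∈ K
        · exact ⟨x, .inr hxK, hxv, Iff.rfl⟩
        · have hzv : z ≠ v := by rintro rfl; exact hz.2 hv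
          refine ⟨z, .inl rfl, hzv, ?_⟩
          by_cases hxz : x = z
          · rw [hxz]
          · exact hG.adj_iff_of_singleArc loopless (hv.2 x hx hxv) (hv.2 z hz.1 hzv) hxz
              fun e => h x ⟨hx, hxK⟩ hxz e.symm
      · rintro x (rfl | hx) y (rfl | hy) hx' hy'
        · rfl
        · exact (hy' hy).elim
        · exact (hx' hx).elim
        · exact (hx' hx).elim
    · have hSK : ∀ x ∈ S, x ∈ K := fun x hx => by_contra fun h => hC ⟨x, hx, h⟩
      exact ⟨K, fun x hx => hx.1, subset_rfl, fun x hx y hy hxy => hx.2 y hy.1 hxy.symm,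
        fun v _ x hx hxv => ⟨x, hSK x hx, hxv, Iff.rfl⟩, fun x hx _ _ hx' => (hx' hx).elim⟩
  have hom : ∀ v ∈ K, ∀ p : Prop, (∀ t ∈ T, t ≠ v → (G.Adj v t ↔ p)) →
      HomogeneousIn G.Adj S v := by
    intro v hv p hp x hx y hy hxv hyv
    have key : ∀ x ∈ S, x ≠ v → (G.Adj v x ↔ p) := fun x hx hxv => by
      obtain ⟨t, ht, htv, e⟩ := hrep v hv x hx hxv
      exact e.trans (hp t ht htv)
    rw [(hv.2 x hx hxv).adj_comm, (hv.2 y hy hyv).adj_comm, key x hx hxv, key y hy hyv]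
    exact ⟨id, id⟩
  have htrans : ∀ x ∈ T, ∀ y ∈ T, ∀ z ∈ T, G.Adj x y → G.Adj y z → G.Adj x z := by
    intro x hx y hy z hz h1 h2
    have hxy : x ≠ y := by rintro rfl; exact loopless _ h1
    have hyz : y ≠ z := by rintro rfl; exact loopless _ h2
    have hxz : x ≠ z := by
      rintro rfl
      exact (hT x hx y hy hxy).adj_comm.mp h2 h1
    exact hG.adj_trans loopless (hT x hx y hy hxy) (hT y hy z hz hyz) (hT x hx z hz hxz) h1 h2
  have htotal : ∀ x ∈ T, ∀ y ∈ T, x ≠ y → G.Adj x y ∨ G.Adj y x := fun x hx y hy hxy =>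
    (hT x hx y hy hxy).elim (fun h => .inl h.1) (fun h => .inr h.1)
  -- The source `s` and the sink `e` of the transitive tournament `T` cannot both lie outside `K`:
  -- they would coincide, contradicting the single arc to `k`.
  obtain ⟨s, hsT, hs⟩ := exists_source T ⟨k, hKT hkK⟩ loopless htotal htrans
  by_cases hsK : s ∈ K
  · exact ⟨s, hTS hsT, hom s hsK True fun t ht hts => iff_true_intro (hs t ht hts)⟩
  obtain ⟨e, heT, he⟩ := exists_source (r := fun x y => G.Adj y x) T ⟨k, hKT hkK⟩ loopless
    (fun x hx y hy hxy => (htotal x hx y hy hxy).symm)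
    (fun x hx y hy z hz h1 h2 => htrans z hz y hy x hx h2 h1)
  by_cases heK : e ∈ K
  · refine ⟨e, hTS heT, hom e heK False fun t ht hte => iff_false_intro ?_⟩
    exact (hT t ht e heT hte).adj_comm.not.mpr (not_not.mpr (he t ht hte))
  · have hse : s = e := hsub s hsT e heT hsK heK
    have hks : k ≠ s := by rintro rfl; exact hsK hkK
    exact ((hT s hsT k (hKT hkK) hks.symm).adj_comm.mp (he k (hKT hkK) (hse ▸ hks) |> (hse ▸ ·))
      (hs k (hKT hkK) hks)).elim

/-- If no vertex of `S` is joined by single arcs to all others, but some vertex of `S` is in no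
single arc, then `S` has a homogeneous vertex. -/
theorem ThresholdFree.exists_homogeneous_of_isolated [Finite V] (hG : ThresholdFree G)
    (loopless : ∀ x, ¬ G.Adj x x) {S : Set V} {k : V} (hkS : k ∈ S)
    (hk : ∀ x ∈ S, ¬ SingleArc G k x) : ∃ v ∈ S, HomogeneousIn G.Adj S v := by
  let Z : Set V := {v ∈ S | ∀ x ∈ S, ¬ SingleArc G v x}
  have hZ : ∀ v ∈ Z, ∀ x ∈ S, (G.Adj v x ↔ G.Adj x v) := fun v hv x hx =>
    not_singleArc_iff.mp (hv.2 x hx)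
  have hom : ∀ v ∈ Z, ∀ p : Prop, (∀ x ∈ S, x ≠ v → (G.Adj v x ↔ p)) →
      HomogeneousIn G.Adj S v := by
    intro v hv p hp x hx y hy hxv hyv
    rw [← hZ v hv x hx, ← hZ v hv y hy, hp x hx hxv, hp y hy hyv]
    exact ⟨id, id⟩
  by_cases hC : (S \ Z).Nonempty
  · obtain ⟨t, ht, h⟩ := exists_isolated_or_dominating (r := SingleArc G)
      (fun _ _ => SingleArc.symm) (S \ Z) hC
      (fun u _ a _ v _ b _ => hG.singleArc_alt loopless)
    -- A vertex isolated in `S \ Z` would be isolated in `S` and so lie in `Z`.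
    replace h : ∀ x ∈ S \ Z, x ≠ t → SingleArc G t x := by
      refine h.resolve_left fun h => ht.2 ⟨ht.1, fun x hx e => ?_⟩
      by_cases hxZ : x ∈ Z
      · exact hxZ.2 t ht.1 e.symm
      · exact h x ⟨hx, hxZ⟩ e.ne.symm e
    obtain ⟨s, hs, hts⟩ : ∃ s ∈ S, SingleArc G t s := by
      by_contra! H
      exact ht.2 ⟨ht.1, H⟩
    have hsZ : s ∉ Z := fun h => h.2 t ht.1 hts.symm
    have hne : ∀ v ∈ Z, ∀ x, x ∉ Z → v ≠ x := fun v hv x hx e => hx (e ▸ hv)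
    -- Since `t` has a single arc to every other vertex of `S \ Z`, a vertex of `Z` is joined to all
    -- of `S \ Z` as it is to `t`.
    have hrep : ∀ v ∈ Z, ∀ x ∈ S, x ∉ Z → (G.Adj v x ↔ G.Adj v t) := by
      intro v hv x hx hxZ
      by_cases hxt : x = t
      · rw [hxt]
      · exact hG.adj_iff_of_not_singleArc loopless (h x ⟨hx, hxZ⟩ hxt).symm (hne v hv x hxZ)
          (hne v hv t ht.2) (hv.2 x hx) (hv.2 t ht.1)
    have hU : ∀ x ∈ insert t Z, ∀ y ∈ insert t Z, ¬ SingleArc G x y := by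
      rintro x (rfl | hx) y (rfl | hy) e
      · exact e.ne rfl
      · exact hy.2 x ht.1 e.symm
      · exact hx.2 y ht.1 e
      · exact hx.2 y hy.1 e
    obtain ⟨v, hv, hv'⟩ : ∃ v ∈ insert t Z, ∃ p : Prop,
        ∀ x ∈ insert t Z, x ≠ v → (G.Adj v x ↔ p) := by
      by_contra! H
      let r : V → V → Prop := fun x y => x ∈ insert t Z ∧ y ∈ insert t Z ∧ G.Adj x y
      obtain ⟨v, hv, h | h⟩ := exists_isolated_or_dominating (r := r)
        (fun x y h => ⟨h.2.1, h.1, (not_singleArc_iff.mp (hU x h.1 y h.2.1)).mp h.2.2⟩)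
        (insert t Z) ⟨t, .inl rfl⟩ (fun u hu a ha v hv b hb hub hva h1 h2 =>
          (hG.adj_alt loopless hU hu ha hv hb hub hva h1.2.2 h2.2.2).imp
            (fun e => ⟨hu, hb, e⟩) (fun e => ⟨hv, ha, e⟩))
      · obtain ⟨x, hx, hxv, hn⟩ := H v hv False
        exact hn.elim (fun e => h x hx hxv ⟨hv, hx, e.1⟩) (fun e => e.2)
      · obtain ⟨x, hx, hxv, hn⟩ := H v hv True
        exact hn.elim (fun e => e.2 trivial) (fun e => e.1 (h x hx hxv).2.2)
    obtain ⟨p, hp⟩ := hv'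
    rcases hv with rfl | hv
    -- The uniform vertex is the representative, which may fail to be homogeneous in `S`. All of `Z`
    -- is then joined in the same way to it and to `s`, the other end of one of its single arcs,
    -- hence within `Z` as well; so `k` is homogeneous.
    · have hkZ : k ∈ Z := ⟨hkS, hk⟩
      have hp' : ∀ x ∈ Z, G.Adj x v ↔ p := fun x hx =>
        (hZ x hx v ht.1).trans (hp x (.inr hx) (hne x hx v ht.2))
      have hps : ∀ x ∈ Z, G.Adj x s ↔ p := fun x hx => (hrep x hx s hs hsZ).trans (hp' x hx)
      refine ⟨k, hkS, hom k hkZ p fun x hx hxk => ?_⟩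
      by_cases hxZ : x ∈ Z
      · exact hG.adj_iff_of_joined loopless hts hxk.symm (hne k hkZ v ht.2) (hne k hkZ s hsZ)
          (hne x hxZ v ht.2) (hne x hxZ s hsZ) (hp' k hkZ)
          ((hZ k hkZ v ht.1).symm.trans (hp' k hkZ)) (hps k hkZ)
          ((hZ k hkZ s hs).symm.trans (hps k hkZ)) (hp' x hxZ)
          ((hZ x hxZ v ht.1).symm.trans (hp' x hxZ)) (hps x hxZ)
          ((hZ x hxZ s hs).symm.trans (hps x hxZ)) (hk x hx)
      · exact (hrep k hkZ x hx hxZ).trans (hp' k hkZ)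
    · refine ⟨v, hv.1, hom v hv p fun x hx hxv => ?_⟩
      by_cases hxZ : x ∈ Z
      · exact hp x (.inr hxZ) hxv
      · exact (hrep v hv x hx hxZ).trans (hp t (.inl rfl) (hne v hv t ht.2).symm)
  · have hSZ : ∀ x ∈ S, x ∈ Z := fun x hx => by_contra fun h => hC ⟨x, hx, h⟩
    have hU : ∀ x ∈ S, ∀ y ∈ S, ¬ SingleArc G x y := fun x hx => (hSZ x hx).2
    let r : V → V → Prop := fun x y => x ∈ S ∧ y ∈ S ∧ G.Adj x y
    obtain ⟨v, hv, h | h⟩ := exists_isolated_or_dominating (r := r)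
      (fun x y h => ⟨h.2.1, h.1, (not_singleArc_iff.mp (hU x h.1 y h.2.1)).mp h.2.2⟩)
      S ⟨k, hkS⟩ (fun u hu a ha v hv b hb hub hva h1 h2 =>
        (hG.adj_alt loopless hU hu ha hv hb hub hva h1.2.2 h2.2.2).imp
          (fun e => ⟨hu, hb, e⟩) (fun e => ⟨hv, ha, e⟩))
    · exact ⟨v, hv, hom v (hSZ v hv) False fun x hx hxv =>
        iff_false_intro fun e => h x hx hxv ⟨hv, hx, e⟩⟩
    · exact ⟨v, hv, hom v (hSZ v hv) True fun x hx hxv => iff_true_intro (h x hx hxv).2.2⟩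

theorem ThresholdFree.dismantlable [Finite V] (hG : ThresholdFree G)
    (loopless : ∀ x, ¬ G.Adj x x) : Dismantlable G.Adj := by
  intro S hS
  obtain ⟨v, hv, h | h⟩ := exists_isolated_or_dominating (r := SingleArc G)
    (fun _ _ => SingleArc.symm) S hS (fun u _ a _ v _ b _ => hG.singleArc_alt loopless)
  · refine hG.exists_homogeneous_of_isolated loopless hv fun x hx e => ?_
    exact h x hx e.ne.symm e
  · exact hG.exists_homogeneous_of_dominating loopless hv h

/-! ### Underlying undirected graphs -/

theorem isIndContained_un {W : Type v} {H : SimpleGraph W} {n : ℕ} {A : List (Fin n × Fin n)}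
    (loopless : ∀ x, ¬ G.Adj x x) {f : Fin n → V} (hf : Function.Injective f)
    (h : ∀ x y, (ofArcs n A).2.Adj x y ↔ G.Adj (f x) (f y)) (g : W → Fin n)
    (hg : Function.Injective g) (hA : ∀ x y, H.Adj x y ↔ (g x, g y) ∈ A ∨ (g y, g x) ∈ A) :
    H.IsIndContained (un G) := by
  refine ⟨⟨⟨fun x => f (g x), hf.comp hg⟩, ?_⟩⟩
  intro x y
  have e : ∀ x y, (x, y) ∈ A ↔ G.Adj (f x) (f y) := h
  rw [hA, e, e]
  change f (g x) ≠ f (g y) ∧ _ ↔ _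
  refine ⟨fun h => h.2, fun h => ⟨fun heq => ?_, h⟩⟩
  rw [heq] at h
  exact h.elim (loopless _) (loopless _)

theorem thresholdFree_of_freeP4TwoK2C4 (loopless : ∀ x, ¬ G.Adj x x)
    (hG : Free {D1, D2, D3, D4, D5, D6, D10, D11, D13, D14, D15} G)
    (hun : FreeP4TwoK2C4 (un G)) : ThresholdFree G := by
  obtain ⟨hP, hK, hC⟩ := hun
  have key : Free {D7, D8, D9, D12, twoDirP2, dirP2BiP2, twoBiP2} G := by
    refine free_of_forall_not_embedding fun H hH f hf h => ?_
    simp only [Set.mem_insert_iff, Set.mem_singleton_iff] at hH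
    rcases hH with rfl | rfl | rfl | rfl | rfl | rfl | rfl
    · exact hP (isIndContained_un (n := 4) loopless hf h id Function.injective_id
        (by simp only [SimpleGraph.pathGraph_adj, id]; decide))
    · exact hP (isIndContained_un (n := 4) loopless hf h id Function.injective_id
        (by simp only [SimpleGraph.pathGraph_adj, id]; decide))
    -- The sides of `D9` and `D12` are {0, 1} and {2, 3}, so the 4-cycle runs 0, 2, 1, 3.
    · exact hC (isIndContained_un (n := 4) loopless hf h ![0, 2, 1, 3] (by decide) (by decide))
    · exact hC (isIndContained_un (n := 4) loopless hf h ![0, 2, 1, 3] (by decide) (by decide))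
    all_goals
      exact hK (isIndContained_un (n := 4) loopless hf h (Sum.elim ![0, 1] ![2, 3]) (by decide)
        (by simp [Sum.forall, Fin.forall_fin_two]))
  exact hG.of_subset_union key (by simp [Set.insert_subset_iff])

end
end DirectedWidth

/-! ### The equivalences -/

open DirectedWidth
theorem mainTheorem10 {V : Type*} [Fintype V] [Nonempty V] (G : Digraph V)
    (loopless : ∀ x, ¬ G.Adj x x) :
    List.TFAE [
      dlnlcw G = 1,
      dnw G = 1,
      dlcw G ≤ 2 ∧ Free {D2, D3, D9, D10, D12, D13, D14} G,
      IsDirectedThreshold G,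
      Free {D1, D2, D3, D4, D5, D6, D7, D8, D9, D10, D11, D12, D13, D14, D15,
        twoDirP2, dirP2BiP2, twoBiP2} G,
      Free {D1, D2, D3, D4, D5, D6, D10, D11, D13, D14, D15} G ∧ FreeP4TwoK2C4 (un G),
      Free {D1, D2, D3, D4, D5, D6, D10, D11, D13, D14, D15} G ∧ IsThreshold (un G)] := by
  have h1 := dlnlcw_eq_one_iff G loopless
  have h2 := dnw_eq_one_iff G
  have h4 : IsDirectedThreshold G ↔ Dismantlable G.Adj :=
    ⟨.of_isDirectedThreshold, fun h => h.isDirectedThreshold loopless⟩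
  have h5 : ThresholdFree G ↔ Dismantlable G.Adj :=
    ⟨fun h => h.dismantlable loopless, fun h => h.free⟩
  tfae_have 1 ↔ 2 := h1.trans h2.symm
  tfae_have 1 ↔ 4 := h1.trans h4.symm
  tfae_have 1 ↔ 5 := h1.trans h5.symm
  tfae_have 5 → 3 := fun h => ⟨(h5.mp h).dlcw_le_two loopless, h.mono (by simp [Set.insert_subset_iff])⟩
  tfae_have 3 → 5 := fun h => h.2.of_subset_union
    (weaklyDismantlable_of_dlcw_le_two h.1).free (by simp [Set.insert_subset_iff])
  tfae_have 5 → 7 := fun h => ⟨h.mono (by simp [Set.insert_subset_iff]), (h5.mp h).un.isThreshold⟩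
  tfae_have 7 → 6 := fun h => ⟨h.1, (Dismantlable.of_isThreshold h.2).freeP4TwoK2C4⟩
  tfae_have 6 → 5 := fun h => thresholdFree_of_freeP4TwoK2C4 loopless h.1 h.2
  tfae_finish
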